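/- There is an absolute constant $c > 0$ such that the following holds for all integers $d \ge 1$, $n_0 \ge 11$ and $n$ such that $\log(n/n_0)$ is a positive integer; here $\log$ denotes the base-$2$ logarithm. Draw $n$ data points and a query $q$ iid from the uniform distribution on $[0,1]^d$, and build the $k$-d tree of the data with minimum leaf size $n_0$: starting with all data points at level $l = 0$, a node of level $l$ with point set $S$ is a leaf if $|S| < 2 n_0$; otherwise let $s$ be the median (the $\lceil |S|/2 \rceil$-th smallest value) of the coordinate $\alpha = (l \bmod d) + 1$ over $S$, and let the left and right children of the node, of level $l+1$, have the points of $S$ with $x_\alpha \le s$ and with $x_\alpha > s$, respectively. Defeatist search on $q$ starts at the root, goes at each inner node to the left child if $q_\alpha \le s$ and to the right child otherwise, and returns the point of the leaf it reaches that is closest to $q$ in Euclidean distance. If $n_0 \ge 2 \log n$, then defeatist search on $q$ returns the nearest neighbor of $q$ among all $n$ data points with probability at least $$1 - 3 n \exp(-c\, n_0) - 24\, d^{3/2} \left( \frac{\log n_0}{n_0} \right)^{1/d}.$$ -/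

import Mathlib

open MeasureTheory

/-- The `k`-th order statistic (`1 ≤ k ≤ |S|`) of the family of reals `(v i)`, `i ∈ S`: the least
real `t` such that at least `k` of the values are `≤ t`. -/
noncomputable def orderStat {ι : Type*} (S : Finset ι) (v : ι → ℝ) (k : ℕ) : ℝ :=
  sInf {t : ℝ | k ≤ (S.filter (fun i => v i ≤ t)).card}

/-- The infimum in `orderStat` is attained, so `orderStat` really is a least element. -/
theorem orderStat_isLeast {ι : Type*} (S : Finset ι) (v : ι → ℝ) (k : ℕ)
    (hk : 1 ≤ k) (hkS : k ≤ S.card) :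
    IsLeast {t : ℝ | k ≤ (S.filter (fun i => v i ≤ t)).card} (orderStat S v k) := by
  classical
  set A : Set ℝ := {t : ℝ | k ≤ (S.filter (fun i => v i ≤ t)).card} with hA
  have hSne : S.Nonempty := Finset.card_pos.mp (by omega)
  set B : Finset ℝ := (S.image v).filter (fun t => t ∈ A) with hB
  have hmax : (S.image v).max' (hSne.image v) ∈ A := by
    have : S.filter (fun i => v i ≤ (S.image v).max' (hSne.image v)) = S :=
      Finset.filter_true_of_mem
        (fun i hi => Finset.le_max' _ _ (Finset.mem_image_of_mem v hi))
    change k ≤ _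
    rw [this]
    exact hkS
  have hBne : B.Nonempty :=
    ⟨_, Finset.mem_filter.mpr ⟨Finset.max'_mem _ _, hmax⟩⟩
  have hleast : IsLeast A (B.min' hBne) := by
    refine ⟨(Finset.mem_filter.mp (Finset.min'_mem B hBne)).2, ?_⟩
    intro t ht
    have ht' : k ≤ (S.filter (fun i => v i ≤ t)).card := ht
    have hne : (S.filter (fun i => v i ≤ t)).Nonempty := Finset.card_pos.mp (by omega)
    obtain ⟨i, hi, hmx⟩ := Finset.exists_max_image _ v hne
    have hi' := Finset.mem_filter.mp hi
    have hvA : v i ∈ A := by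
      refine le_trans ht' (Finset.card_le_card ?_)
      intro j hj
      exact Finset.mem_filter.mpr ⟨(Finset.mem_filter.mp hj).1, hmx j hj⟩
    exact (Finset.min'_le B _ (Finset.mem_filter.mpr
      ⟨Finset.mem_image_of_mem v hi'.1, hvA⟩)).trans hi'.2
  have heq : orderStat S v k = B.min' hBne := hleast.csInf_eq
  rw [heq]
  exact hleast

/-- The median of `m = |S|` numbers: the `⌈m / 2⌉`-th order statistic. -/
noncomputable def median {ι : Type*} (S : Finset ι) (v : ι → ℝ) : ℝ :=
  orderStat S v ((S.card + 1) / 2)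

/-- Binary trees whose inner nodes carry the rule `x ↦ (x α ≤ s)` and whose leaves carry a finite
set of (indices of) data points. -/
inductive KDTree (n d : ℕ) : Type
  | leaf (S : Finset (Fin n)) : KDTree n d
  | node (α : Fin d) (s : ℝ) (left right : KDTree n d) : KDTree n d

/-- The coordinate split at level `l` (round-robin; coordinates are numbered from `0`). -/
def splitCoord (d : ℕ) [NeZero d] (l : ℕ) : Fin d :=
  ⟨l % d, Nat.mod_lt l (NeZero.pos d)⟩

/-- The position at which the points with indices in `S` are split at level `l`. -/
noncomputable def splitPos {n d : ℕ} [NeZero d] (p : Fin n → EuclideanSpace ℝ (Fin d))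
    (S : Finset (Fin n)) (l : ℕ) : ℝ :=
  median S (fun i => p i (splitCoord d l))

/-- The points of `S` satisfying the rule. -/
noncomputable def leftPart {n d : ℕ} [NeZero d] (p : Fin n → EuclideanSpace ℝ (Fin d))
    (S : Finset (Fin n)) (l : ℕ) : Finset (Fin n) :=
  S.filter (fun i => p i (splitCoord d l) ≤ splitPos p S l)

/-- The points of `S` not satisfying the rule. -/
noncomputable def rightPart {n d : ℕ} [NeZero d] (p : Fin n → EuclideanSpace ℝ (Fin d))
    (S : Finset (Fin n)) (l : ℕ) : Finset (Fin n) :=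
  S.filter (fun i => ¬ p i (splitCoord d l) ≤ splitPos p S l)

theorem card_leftPart_add_card_rightPart {n d : ℕ} [NeZero d]
    (p : Fin n → EuclideanSpace ℝ (Fin d)) (S : Finset (Fin n)) (l : ℕ) :
    (leftPart p S l).card + (rightPart p S l).card = S.card :=
  Finset.card_filter_add_card_filter_not _

/-- Construction of the `k`-d tree with minimum leaf size `n₀` from the data points `p i`,
`i ∈ S`, starting at level `l`. The second test only makes the recursion terminate on degenerate
data: for `|S| ≥ 2 n₀ ≥ 2` it succeeds only if at least half of the points of `S` share the same
value of the coordinate that is to be split, which has probability zero for data from an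
absolutely continuous distribution. -/
noncomputable def buildTree {n d : ℕ} [NeZero d] (p : Fin n → EuclideanSpace ℝ (Fin d))
    (n₀ : ℕ) (S : Finset (Fin n)) (l : ℕ) : KDTree n d :=
  if S.card < 2 * n₀ then
    KDTree.leaf S
  else if h : leftPart p S l = ∅ ∨ rightPart p S l = ∅ then
    KDTree.leaf S
  else
    KDTree.node (splitCoord d l) (splitPos p S l)
      (buildTree p n₀ (leftPart p S l) (l + 1))
      (buildTree p n₀ (rightPart p S l) (l + 1))
termination_by S.card
decreasing_by
  all_goals
    have h1 := card_leftPart_add_card_rightPart p S l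
    have h2 : 0 < (leftPart p S l).card :=
      Finset.card_pos.mpr (Finset.nonempty_iff_ne_empty.mpr (fun e => h (Or.inl e)))
    have h3 : 0 < (rightPart p S l).card :=
      Finset.card_pos.mpr (Finset.nonempty_iff_ne_empty.mpr (fun e => h (Or.inr e)))
    omega

/-- Defeatist search: follow the rules with the query `q` down to a leaf and return (the index of)
the point of that leaf closest to `q`; ties go to the smallest index, and the value is `none` only
if the leaf is empty. -/
noncomputable def defeatistSearch {n d : ℕ} (p : Fin n → EuclideanSpace ℝ (Fin d))
    (q : EuclideanSpace ℝ (Fin d)) : KDTree n d → Option (Fin n)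
  | KDTree.leaf S => (S.sort (· ≤ ·)).argmin (fun i => ‖p i - q‖)
  | KDTree.node α s left right =>
      if q α ≤ s then defeatistSearch p q left else defeatistSearch p q right

/-- `p i` is a nearest neighbor of `q` among all data points. -/
def IsNearestNeighbor {n d : ℕ} (p : Fin n → EuclideanSpace ℝ (Fin d))
    (q : EuclideanSpace ℝ (Fin d)) (i : Fin n) : Prop :=
  ∀ j, ‖p i - q‖ ≤ ‖p j - q‖

/-- Defeatist search for `q` on the `k`-d tree with minimum leaf size `n₀` built from all the data
points `p` returns the nearest neighbor of `q`. -/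
def DefeatistSucceeds {n d : ℕ} [NeZero d] (n₀ : ℕ) (p : Fin n → EuclideanSpace ℝ (Fin d))
    (q : EuclideanSpace ℝ (Fin d)) : Prop :=
  ∃ i, defeatistSearch p q (buildTree p n₀ Finset.univ 0) = some i ∧ IsNearestNeighbor p q i

/-- The unit cube `[0,1]^d` in Euclidean space. -/
def unitCube (d : ℕ) : Set (EuclideanSpace ℝ (Fin d)) :=
  {x | ∀ i, x i ∈ Set.Icc (0 : ℝ) 1}

/-- The uniform distribution on `[0,1]^d`: Lebesgue measure restricted to the cube. -/
noncomputable def uniformCube (d : ℕ) : Measure (EuclideanSpace ℝ (Fin d)) :=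
  volume.restrict (unitCube d)

instance uniformCube_isProbabilityMeasure (d : ℕ) : IsProbabilityMeasure (uniformCube d) := by
  refine ⟨?_⟩
  have hmp := EuclideanSpace.volume_preserving_symm_measurableEquiv_toLp (Fin d)
  have hset : unitCube d = (MeasurableEquiv.toLp 2 (Fin d → ℝ)).symm ⁻¹'
      (Set.univ.pi fun _ => Set.Icc (0 : ℝ) 1) := by
    ext x
    simp [unitCube, Set.mem_pi, -Set.pi_univ_Icc]
  rw [uniformCube, Measure.restrict_apply_univ, hset,
    hmp.measure_preimage (MeasurableSet.univ_pi fun _ => measurableSet_Icc).nullMeasurableSet,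
    volume_pi_pi]
  simp

/-- The joint law of `n` data points and a query drawn independently from the uniform distribution
on `[0,1]^d`. -/
noncomputable def dataQueryLaw (n d : ℕ) :
    Measure ((Fin n → EuclideanSpace ℝ (Fin d)) × EuclideanSpace ℝ (Fin d)) :=
  (Measure.pi fun _ => uniformCube d).prod (uniformCube d)

/-! Put `ρ = √d * t`, where `n * t ^ d = logb 2 n₀`. If some data point is within `ρ` of the query
and the query is farther than `ρ` from every splitting hyperplane on its path, then all data within
`ρ` of the query end in its leaf and the search succeeds (`defeatistSucceeds_of_notMem_nearSplit`).
Two events remain to be bounded.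

No data nearby: the sup-norm ball of radius `t` about a query in the cube has mass at least `t ^ d`,
even at a corner, so it misses all the data with probability at most `exp (-(n * t ^ d)) ≤ 1 / n₀`.

Query near a hyperplane, for fixed data: in a cell of side at least `A` along the split, the slab of
half-width `ρ` has at most the fraction `2 * ρ / A` of the volume. The cells of one level overlap
only in boundaries, so these fractions just add up over the levels
(`volume_coordIcc_inter_nearSplit_le`). If every split side is at least a quarter of its ideal value
`2 ^ (-⌊l / d⌋)`, the sum is at most `16 * d * ρ * 2 ^ (k / d)`, which is `16 * d ^ (3 / 2) * (logb
2 n₀ / n₀) ^ (1 / d)`.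

The sides are that long with high probability. Cells depend on the data, so Chernoff bounds are
applied to all boxes of a deterministic grid (`GridRegular`), and cells are rounded outward or
inward to it. A child holds half of its parent's points, hence has about half of its volume; since
only one side changes, that side is about halved (`BalancedCell.child`). The relative errors add up
along a branch. They form a geometric series dominated by the deepest levels, so they stay bounded
whatever the depth. The union bound over the grid is absorbed by `3 * n * exp (-c * n₀)`, because
nothing needs proof unless both error terms are below 1, and this forces `n₀` to be huge and `d ≤
log n₀`. -/

/-! ### Order statistics: characterization, behaviour without ties, measurability. -/

section OrderStat

variable {ι : Type*}

theorem orderStat_le_iff {S : Finset ι} {v : ι → ℝ} {k : ℕ} (hk : 1 ≤ k) (hkS : k ≤ S.card)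
    {t : ℝ} : orderStat S v k ≤ t ↔ k ≤ (S.filter (fun i => v i ≤ t)).card := by
  have h := orderStat_isLeast S v k hk hkS
  refine ⟨fun ht => le_trans h.1 (Finset.card_le_card ?_), fun ht => h.2 ht⟩
  exact Finset.monotone_filter_right _ fun i _ hi => le_trans hi ht

theorem card_filter_lt_orderStat {S : Finset ι} {v : ι → ℝ} {k : ℕ} (hk : 1 ≤ k)
    (hkS : k ≤ S.card) : (S.filter (fun i => v i < orderStat S v k)).card < k := by
  by_contra! hcon
  have hne : (S.filter (fun i => v i < orderStat S v k)).Nonempty :=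
    Finset.card_pos.mp (by omega)
  obtain ⟨i, hi, hmx⟩ := Finset.exists_max_image _ v hne
  have hi' := Finset.mem_filter.mp hi
  have : orderStat S v k ≤ v i := by
    rw [orderStat_le_iff hk hkS]
    refine hcon.trans (Finset.card_le_card fun j hj => ?_)
    exact Finset.mem_filter.mpr ⟨(Finset.mem_filter.mp hj).1, hmx j hj⟩
  linarith [hi'.2]

theorem card_filter_le_orderStat {S : Finset ι} {v : ι → ℝ} {k : ℕ} (hk : 1 ≤ k)
    (hkS : k ≤ S.card) (hv : Set.InjOn v S) :
    (S.filter (fun i => v i ≤ orderStat S v k)).card = k := by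
  classical
  refine le_antisymm ?_ ((orderStat_le_iff hk hkS).1 le_rfl)
  have h1 := card_filter_lt_orderStat hk hkS (v := v)
  have h2 : (S.filter (fun i => v i = orderStat S v k)).card ≤ 1 := by
    rw [Finset.card_le_one]
    intro a ha b hb
    rw [Finset.mem_filter] at ha hb
    exact hv ha.1 hb.1 (ha.2.trans hb.2.symm)
  have h3 : S.filter (fun i => v i ≤ orderStat S v k) ⊆
      S.filter (fun i => v i < orderStat S v k) ∪ S.filter (fun i => v i = orderStat S v k) := by
    intro i hi
    rw [Finset.mem_filter] at hi
    rw [Finset.mem_union, Finset.mem_filter, Finset.mem_filter]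
    rcases hi.2.lt_or_eq with h | h
    · exact Or.inl ⟨hi.1, h⟩
    · exact Or.inr ⟨hi.1, h⟩
  have h4 := (Finset.card_le_card h3).trans (Finset.card_union_le _ _)
  omega

theorem orderStat_mem_Icc {S : Finset ι} {v : ι → ℝ} {k : ℕ} (hk : 1 ≤ k) (hkS : k ≤ S.card)
    {a b : ℝ} (hab : ∀ i ∈ S, v i ∈ Set.Icc a b) : orderStat S v k ∈ Set.Icc a b := by
  constructor
  · have h := (orderStat_le_iff (v := v) hk hkS).1 le_rfl
    obtain ⟨i, hi⟩ := Finset.card_pos.mp (lt_of_lt_of_le hk h)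
    rw [Finset.mem_filter] at hi
    exact (hab i hi.1).1.trans hi.2
  · rw [orderStat_le_iff hk hkS, Finset.filter_true_of_mem fun i hi => (hab i hi).2]
    exact hkS

theorem measurable_orderStat {S : Finset ι} {k : ℕ} (hk : 1 ≤ k) (hkS : k ≤ S.card) :
    Measurable fun v : ι → ℝ => orderStat S v k := by
  classical
  refine measurable_of_Iic fun t => ?_
  have : (fun v : ι → ℝ => orderStat S v k) ⁻¹' Set.Iic t =
      {v | k ≤ ∑ i ∈ S, if v i ≤ t then 1 else 0} := by
    ext v
    simp [orderStat_le_iff hk hkS]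
  rw [this]
  refine measurableSet_le measurable_const (Finset.measurable_sum _ fun i _ => ?_)
  exact Measurable.ite (measurableSet_le (measurable_pi_apply i) measurable_const)
    measurable_const measurable_const

end OrderStat

/-! ### Median splits of a point set. -/

section Split

variable {n d : ℕ} [NeZero d]

theorem measurable_splitPos {S : Finset (Fin n)} (hS : S.Nonempty) (l : ℕ) :
    Measurable fun p : Fin n → EuclideanSpace ℝ (Fin d) => splitPos p S l := by
  have hc := hS.card_pos
  refine (measurable_orderStat (S := S) (by omega) (by omega)).comp ?_
  fun_prop

theorem measurableSet_leftPart_eq (S T : Finset (Fin n)) (l : ℕ) :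
    MeasurableSet {p : Fin n → EuclideanSpace ℝ (Fin d) | leftPart p S l = T} := by
  rcases S.eq_empty_or_nonempty with rfl | hS
  · simp [leftPart]
  have : {p : Fin n → EuclideanSpace ℝ (Fin d) | leftPart p S l = T} =
      ⋂ i : Fin n, {p | (i ∈ S ∧ p i (splitCoord d l) ≤ splitPos p S l) ↔ i ∈ T} := by
    ext p
    simp [leftPart, Finset.ext_iff]
  rw [this]
  have hm : ∀ i, MeasurableSet {p : Fin n → EuclideanSpace ℝ (Fin d) |
      p i (splitCoord d l) ≤ splitPos p S l} := fun i =>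
    measurableSet_le (by fun_prop) (measurable_splitPos hS l)
  exact MeasurableSet.iInter fun i =>
    ((MeasurableSet.const _).inter (hm i)).iff (MeasurableSet.const _)

theorem rightPart_eq_sdiff (p : Fin n → EuclideanSpace ℝ (Fin d)) (S : Finset (Fin n)) (l : ℕ) :
    rightPart p S l = S \ leftPart p S l := by
  rw [rightPart, leftPart, Finset.filter_not]

theorem card_leftPart_of_injective {p : Fin n → EuclideanSpace ℝ (Fin d)} {S : Finset (Fin n)}
    {l m : ℕ} (hm : 1 ≤ m) (hS : S.card = 2 * m)
    (hp : Function.Injective fun i => p i (splitCoord d l)) :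
    (leftPart p S l).card = m := by
  have h := card_filter_le_orderStat (S := S) (v := fun i => p i (splitCoord d l)) (k := m) hm
    (by omega) hp.injOn
  rw [leftPart, splitPos, median]
  have e : (S.card + 1) / 2 = m := by omega
  rw [e]
  exact h

theorem card_rightPart_of_injective {p : Fin n → EuclideanSpace ℝ (Fin d)} {S : Finset (Fin n)}
    {l m : ℕ} (hm : 1 ≤ m) (hS : S.card = 2 * m)
    (hp : Function.Injective fun i => p i (splitCoord d l)) :
    (rightPart p S l).card = m := by
  have h := card_leftPart_add_card_rightPart p S l
  have h' := card_leftPart_of_injective hm hS hp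
  omega

theorem splitPos_mem_Icc {p : Fin n → EuclideanSpace ℝ (Fin d)} {S : Finset (Fin n)} {l : ℕ}
    (hS : S.Nonempty) {a b : ℝ} (hab : ∀ i ∈ S, p i (splitCoord d l) ∈ Set.Icc a b) :
    splitPos p S l ∈ Set.Icc a b := by
  have hc := hS.card_pos
  exact orderStat_mem_Icc (by omega) (by omega) hab

end Split

/-! ### Queries close to a splitting hyperplane, and correctness away from them. -/

section NearSplit

variable {n d : ℕ}

/-- The queries within distance `ρ` of a splitting hyperplane met on their way to a leaf. -/
def nearSplit (ρ : ℝ) : KDTree n d → Set (EuclideanSpace ℝ (Fin d))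
  | KDTree.leaf _ => ∅
  | KDTree.node α s left right =>
      {q | |q α - s| ≤ ρ} ∪ ({q | q α ≤ s} ∩ nearSplit ρ left) ∪
        ({q | ¬ q α ≤ s} ∩ nearSplit ρ right)

/-- A data point within `ρ` of `q` differs from `q` by at most `ρ` in the split coordinate, while
`q` is more than `ρ` from the threshold; so both go to the same side at each node. -/
theorem exists_leaf_of_notMem_nearSplit [NeZero d] {ρ : ℝ}
    {p : Fin n → EuclideanSpace ℝ (Fin d)} {n₀ : ℕ} {q : EuclideanSpace ℝ (Fin d)}
    (S : Finset (Fin n)) (l : ℕ) (hq : q ∉ nearSplit ρ (buildTree p n₀ S l)) :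
    ∃ T : Finset (Fin n),
      defeatistSearch p q (buildTree p n₀ S l) =
        (T.sort (· ≤ ·)).argmin (fun i => ‖p i - q‖) ∧
      ∀ j ∈ S, ‖p j - q‖ ≤ ρ → j ∈ T := by
  induction S, l using buildTree.induct p n₀ with
  | case1 S l h =>
    refine ⟨S, ?_, fun j hj _ => hj⟩
    rw [buildTree, if_pos h, defeatistSearch]
  | case2 S l h h' =>
    refine ⟨S, ?_, fun j hj _ => hj⟩
    rw [buildTree, if_neg h, dif_pos h', defeatistSearch]
  | case3 S l h h' ihl ihr =>
    rw [buildTree, if_neg h, dif_neg h'] at hq ⊢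
    rw [nearSplit] at hq
    simp only [Set.mem_union, Set.mem_inter_iff, Set.mem_ofPred_eq, not_or, not_and, not_le] at hq
    obtain ⟨⟨hfar, hl⟩, hr⟩ := hq
    have hcoord : ∀ j, ‖p j - q‖ ≤ ρ →
        |p j (splitCoord d l) - q (splitCoord d l)| ≤ ρ := fun j hj => by
      refine le_trans ?_ hj
      have := PiLp.norm_apply_le (p j - q) (splitCoord d l)
      simpa using this
    rw [defeatistSearch]
    split_ifs with hside
    · obtain ⟨T, hT, hT'⟩ := ihl (hl hside)
      refine ⟨T, hT, fun j hj hjq => hT' j ?_ hjq⟩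
      rw [leftPart, Finset.mem_filter]
      refine ⟨hj, ?_⟩
      have h1 := (abs_le.1 (hcoord j hjq)).2
      rw [abs_of_nonpos (by linarith)] at hfar
      linarith
    · obtain ⟨T, hT, hT'⟩ := ihr (hr (not_le.1 hside))
      refine ⟨T, hT, fun j hj hjq => hT' j ?_ hjq⟩
      rw [rightPart, Finset.mem_filter]
      refine ⟨hj, ?_⟩
      have h1 := (abs_le.1 (hcoord j hjq)).1
      rw [abs_of_nonneg (by linarith)] at hfar
      linarith

theorem defeatistSucceeds_of_notMem_nearSplit [NeZero d] {ρ : ℝ}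
    {p : Fin n → EuclideanSpace ℝ (Fin d)} {n₀ : ℕ} {q : EuclideanSpace ℝ (Fin d)}
    (hq : q ∉ nearSplit ρ (buildTree p n₀ Finset.univ 0)) (hp : ∃ i, ‖p i - q‖ ≤ ρ) :
    DefeatistSucceeds n₀ p q := by
  obtain ⟨T, hT, hT'⟩ := exists_leaf_of_notMem_nearSplit Finset.univ 0 hq
  obtain ⟨i, hi⟩ := hp
  have hiT := hT' i (Finset.mem_univ i) hi
  cases hmin : (T.sort (· ≤ ·)).argmin (fun i => ‖p i - q‖) with
  | none =>
    rw [List.argmin_eq_none] at hmin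
    have : i ∈ T.sort (· ≤ ·) := (Finset.mem_sort _).2 hiT
    rw [hmin] at this
    simp at this
  | some a =>
    refine ⟨a, hT.trans hmin, fun j => ?_⟩
    have hle : ∀ j ∈ T, ‖p a - q‖ ≤ ‖p j - q‖ := fun j hj =>
      List.le_of_mem_argmin (f := fun i => ‖p i - q‖) ((Finset.mem_sort _).2 hj) hmin
    by_cases hj : ‖p j - q‖ ≤ ρ
    · exact hle j (hT' j (Finset.mem_univ j) hj)
    -- Points outside the `ρ`-ball may be missing from the leaf, but they are farther than the
    -- witness `i`.
    · exact (hle i hiT).trans (hi.trans (not_le.1 hj).le)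

/-- The tree itself varies with the data. Partitioning by the finitely many values of `leftPart`
fixes the index sets of both children, so the induction on cardinality applies to them. -/
theorem measurableSet_nearSplit_buildTree [NeZero d] (ρ : ℝ) (n₀ : ℕ) (S : Finset (Fin n))
    (l : ℕ) :
    MeasurableSet {ω : (Fin n → EuclideanSpace ℝ (Fin d)) × EuclideanSpace ℝ (Fin d) |
      ω.2 ∈ nearSplit ρ (buildTree ω.1 n₀ S l)} := by
  induction hc : S.card using Nat.strong_induction_on generalizing S l with
  | _ c ih =>
    subst hc
    by_cases h : S.card < 2 * n₀
    · refine MeasurableSet.congr MeasurableSet.empty (Set.ext fun ω => ?_)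
      rw [Set.mem_ofPred_eq]
      rw [buildTree, if_pos h, nearSplit]
      simp only [Set.mem_empty_iff_false]
    rcases S.eq_empty_or_nonempty with rfl | hS
    · refine MeasurableSet.congr MeasurableSet.empty (Set.ext fun ω => ?_)
      rw [Set.mem_ofPred_eq]
      rw [buildTree, if_neg h, dif_pos (by simp [leftPart]), nearSplit]
      simp only [Set.mem_empty_iff_false]
    have hset : {ω : (Fin n → EuclideanSpace ℝ (Fin d)) × EuclideanSpace ℝ (Fin d) |
        ω.2 ∈ nearSplit ρ (buildTree ω.1 n₀ S l)} =
        ⋃ T ∈ S.powerset.filter (fun T => ¬ (T = ∅ ∨ S \ T = ∅)),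
          {ω | leftPart ω.1 S l = T} ∩
          ({ω | |ω.2 (splitCoord d l) - splitPos ω.1 S l| ≤ ρ} ∪
            ({ω | ω.2 (splitCoord d l) ≤ splitPos ω.1 S l} ∩
              {ω | ω.2 ∈ nearSplit ρ (buildTree ω.1 n₀ T (l + 1))}) ∪
            ({ω | ¬ ω.2 (splitCoord d l) ≤ splitPos ω.1 S l} ∩
              {ω | ω.2 ∈ nearSplit ρ (buildTree ω.1 n₀ (S \ T) (l + 1))})) := by
      ext ω
      simp only [Set.mem_iUnion, exists_prop, Set.mem_inter_iff, Finset.mem_filter,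
        Finset.mem_powerset, Set.mem_ofPred_eq]
      rw [buildTree, if_neg h]
      split_ifs with h'
      · rw [nearSplit]
        refine ⟨fun hf => hf.elim, ?_⟩
        rintro ⟨T, ⟨_, hT⟩, rfl, _⟩
        rw [← rightPart_eq_sdiff] at hT
        exact (hT h').elim
      · rw [nearSplit, rightPart_eq_sdiff]
        rw [rightPart_eq_sdiff] at h'
        constructor
        · intro hω
          exact ⟨_, ⟨Finset.filter_subset _ _, h'⟩, rfl, hω⟩
        · rintro ⟨T, _, rfl, hω⟩
          exact hω
    rw [hset]
    have hs : Measurable fun ω : (Fin n → EuclideanSpace ℝ (Fin d)) ×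
        EuclideanSpace ℝ (Fin d) => splitPos ω.1 S l :=
      (measurable_splitPos hS l).comp measurable_fst
    have hx : Measurable fun ω : (Fin n → EuclideanSpace ℝ (Fin d)) ×
        EuclideanSpace ℝ (Fin d) => ω.2 (splitCoord d l) := by fun_prop
    refine Finset.measurableSet_biUnion _ fun T hT => ?_
    simp only [Finset.mem_filter, Finset.mem_powerset, not_or] at hT
    obtain ⟨hTS, hT1, hT2⟩ := hT
    have hc1 := Finset.card_pos.2 (Finset.nonempty_iff_ne_empty.2 hT1)
    have hc2 := Finset.card_pos.2 (Finset.nonempty_iff_ne_empty.2 hT2)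
    have hc3 := Finset.card_sdiff_add_card_eq_card hTS
    have hle := measurableSet_le hx hs
    exact (measurable_fst (measurableSet_leftPart_eq S T l)).inter
      (((measurableSet_le (measurable_norm.comp (hx.sub hs)) measurable_const).union
        (hle.inter (ih _ (by omega) T (l + 1) rfl))).union
        (hle.compl.inter (ih _ (by omega) (S \ T) (l + 1) rfl)))

end NearSplit

/-! ### Volumes of coordinate boxes and slabs. -/

section Box

variable {d : ℕ}

theorem volume_coordBox (I : Fin d → Set ℝ) (hI : ∀ j, MeasurableSet (I j)) :
    volume {x : EuclideanSpace ℝ (Fin d) | ∀ j, x j ∈ I j} = ∏ j, volume (I j) := by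
  have hmp := EuclideanSpace.volume_preserving_symm_measurableEquiv_toLp (Fin d)
  have hset : {x : EuclideanSpace ℝ (Fin d) | ∀ j, x j ∈ I j} =
      (MeasurableEquiv.toLp 2 (Fin d → ℝ)).symm ⁻¹' (Set.univ.pi I) := by
    ext x
    simp [Set.mem_pi]
  rw [hset, hmp.measure_preimage (MeasurableSet.univ_pi hI).nullMeasurableSet, volume_pi_pi]

theorem volume_coordIcc {lo hi : Fin d → ℝ} (h : ∀ j, lo j ≤ hi j) :
    volume {x : EuclideanSpace ℝ (Fin d) | ∀ j, x j ∈ Set.Icc (lo j) (hi j)} =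
      ENNReal.ofReal (∏ j, (hi j - lo j)) := by
  rw [volume_coordBox _ fun j => measurableSet_Icc,
    ENNReal.ofReal_prod_of_nonneg fun j _ => sub_nonneg.2 (h j)]
  simp

theorem measurableSet_coordBox (I : Fin d → Set ℝ) (hI : ∀ j, MeasurableSet (I j)) :
    MeasurableSet {x : EuclideanSpace ℝ (Fin d) | ∀ j, x j ∈ I j} := by
  rw [show {x : EuclideanSpace ℝ (Fin d) | ∀ j, x j ∈ I j} = ⋂ j, {x | x j ∈ I j} by ext; simp]
  exact MeasurableSet.iInter fun j => (by fun_prop : Measurable fun x :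
    EuclideanSpace ℝ (Fin d) => x j) (hI j)

theorem prod_sub_update_hi (lo hi : Fin d → ℝ) (α : Fin d) (s : ℝ) :
    ∏ j, (Function.update hi α s j - lo j) =
      (s - lo α) * ∏ j ∈ Finset.univ.erase α, (hi j - lo j) := by
  rw [← Finset.mul_prod_erase _ _ (Finset.mem_univ α), Function.update_self]
  congr 1
  refine Finset.prod_congr rfl fun j hj => ?_
  rw [Function.update_of_ne (Finset.ne_of_mem_erase hj)]

theorem prod_sub_update_lo (lo hi : Fin d → ℝ) (α : Fin d) (s : ℝ) :
    ∏ j, (hi j - Function.update lo α s j) =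
      (hi α - s) * ∏ j ∈ Finset.univ.erase α, (hi j - lo j) := by
  rw [← Finset.mul_prod_erase _ _ (Finset.mem_univ α), Function.update_self]
  congr 1
  refine Finset.prod_congr rfl fun j hj => ?_
  rw [Function.update_of_ne (Finset.ne_of_mem_erase hj)]

theorem volume_slab_inter_coordIcc_le {lo hi : Fin d → ℝ} (h : ∀ j, lo j ≤ hi j) (α : Fin d)
    {s ρ : ℝ} (hρ : 0 ≤ ρ) :
    volume ({x : EuclideanSpace ℝ (Fin d) | ∀ j, x j ∈ Set.Icc (lo j) (hi j)} ∩
        {x | |x α - s| ≤ ρ}) ≤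
      ENNReal.ofReal (2 * ρ * ∏ j ∈ Finset.univ.erase α, (hi j - lo j)) := by
  have hsub : {x : EuclideanSpace ℝ (Fin d) | ∀ j, x j ∈ Set.Icc (lo j) (hi j)} ∩
      {x | |x α - s| ≤ ρ} ⊆ {x | ∀ j, x j ∈ Set.Icc (Function.update lo α (s - ρ) j)
        (Function.update hi α (s + ρ) j)} := by
    rintro x ⟨hx, hxs⟩ j
    rcases eq_or_ne j α with rfl | hj
    · have := abs_le.1 (Set.mem_ofPred.1 hxs)
      simp only [Function.update_self]
      exact ⟨by linarith, by linarith⟩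
    · simpa only [Function.update_of_ne hj] using hx j
  refine (measure_mono hsub).trans (le_of_eq ?_)
  rw [volume_coordIcc, ← Finset.mul_prod_erase _ _ (Finset.mem_univ α)]
  · simp only [Function.update_self]
    congr 2
    · ring
    · refine Finset.prod_congr rfl fun j hj => ?_
      rw [Function.update_of_ne (Finset.ne_of_mem_erase hj),
        Function.update_of_ne (Finset.ne_of_mem_erase hj)]
  · intro j
    rcases eq_or_ne j α with rfl | hj
    · simp only [Function.update_self]
      linarith
    · simpa only [Function.update_of_ne hj] using h j

end Box

/-! ### Volume near the hyperplanes of a tree with long split sides. -/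

section SidesOK

variable {n d : ℕ}

/-- The cells of the tree, starting from the box with corners `lo` and `hi`, have length at least
`A l` in the coordinate in which they are split at level `l`. -/
def SidesOK (A : ℕ → ℝ) : KDTree n d → ℕ → (Fin d → ℝ) → (Fin d → ℝ) → Prop
  | KDTree.leaf _, _, _, _ => True
  | KDTree.node α s left right, l, lo, hi =>
      s ∈ Set.Icc (lo α) (hi α) ∧ A l ≤ hi α - lo α ∧
        SidesOK A left (l + 1) lo (Function.update hi α s) ∧
        SidesOK A right (l + 1) (Function.update lo α s) hi

/-- The number of inner nodes on a longest branch. -/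
def KDTree.depth : KDTree n d → ℕ
  | KDTree.leaf _ => 0
  | KDTree.node _ _ left right => max left.depth right.depth + 1

/-- The root slab costs the fraction `2 * ρ / A l` of the box. The two child boxes have volumes
adding up to that of the parent and satisfy the same bound for the remaining levels, so the sum does
not double from level to level. -/
theorem volume_coordIcc_inter_nearSplit_le {ρ : ℝ} (hρ : 0 ≤ ρ) {A : ℕ → ℝ} (hA : ∀ l, 0 < A l)
    (T : KDTree n d) (l r : ℕ) (lo hi : Fin d → ℝ) (hlohi : ∀ j, lo j ≤ hi j)
    (hT : SidesOK A T l lo hi) (hr : T.depth ≤ r) :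
    volume ({x : EuclideanSpace ℝ (Fin d) | ∀ j, x j ∈ Set.Icc (lo j) (hi j)} ∩
        nearSplit ρ T) ≤
      ENNReal.ofReal ((∏ j, (hi j - lo j)) * ∑ i ∈ Finset.range r, 2 * ρ / A (l + i)) := by
  induction T generalizing l r lo hi with
  | leaf S => simp [nearSplit]
  | node α s left right ihl ihr =>
    obtain ⟨hs, hAl, hl, hr'⟩ := hT
    rw [KDTree.depth] at hr
    obtain ⟨r, rfl⟩ : ∃ r', r = r' + 1 := ⟨r - 1, by omega⟩
    have hloL : ∀ j, lo j ≤ Function.update hi α s j := fun j => by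
      rcases eq_or_ne j α with rfl | hj
      · simpa using hs.1
      · simpa only [Function.update_of_ne hj] using hlohi j
    have hhiR : ∀ j, Function.update lo α s j ≤ hi j := fun j => by
      rcases eq_or_ne j α with rfl | hj
      · simpa using hs.2
      · simpa only [Function.update_of_ne hj] using hlohi j
    have hL := ihl (l + 1) r lo _ hloL hl (by omega)
    have hR := ihr (l + 1) r _ hi hhiR hr' (by omega)
    rw [prod_sub_update_hi] at hL
    rw [prod_sub_update_lo] at hR
    set P := ∏ j ∈ Finset.univ.erase α, (hi j - lo j) with hP
    have hP0 : 0 ≤ P := Finset.prod_nonneg fun j _ => sub_nonneg.2 (hlohi j)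
    set B := ∑ i ∈ Finset.range r, 2 * ρ / A (l + 1 + i) with hB
    have hB0 : 0 ≤ B := Finset.sum_nonneg fun i _ => by have := hA (l + 1 + i); positivity
    have hsub : {x : EuclideanSpace ℝ (Fin d) | ∀ j, x j ∈ Set.Icc (lo j) (hi j)} ∩
        nearSplit ρ (KDTree.node α s left right) ⊆
        (({x | ∀ j, x j ∈ Set.Icc (lo j) (hi j)} ∩ {x | |x α - s| ≤ ρ}) ∪
          ({x | ∀ j, x j ∈ Set.Icc (lo j) (Function.update hi α s j)} ∩ nearSplit ρ left)) ∪
          ({x | ∀ j, x j ∈ Set.Icc (Function.update lo α s j) (hi j)} ∩ nearSplit ρ right) := by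
      rintro x ⟨hx, (hx1 | ⟨hx1, hx2⟩) | ⟨hx1, hx2⟩⟩
      · exact Or.inl (Or.inl ⟨hx, hx1⟩)
      · refine Or.inl (Or.inr ⟨fun j => ?_, hx2⟩)
        rcases eq_or_ne j α with rfl | hj
        · simpa using ⟨(hx j).1, hx1⟩
        · simpa only [Function.update_of_ne hj] using hx j
      · refine Or.inr ⟨fun j => ?_, hx2⟩
        rcases eq_or_ne j α with rfl | hj
        · simpa using ⟨(not_le.1 hx1).le, (hx j).2⟩
        · simpa only [Function.update_of_ne hj] using hx j
    refine (measure_mono hsub).trans ((measure_union_le _ _).trans ?_)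
    refine (add_le_add ((measure_union_le _ _).trans (add_le_add
      (volume_slab_inter_coordIcc_le hlohi α hρ) hL)) hR).trans ?_
    have h1 : 0 ≤ (s - lo α) * P * B := by have := sub_nonneg.2 hs.1; positivity
    have h2 : 0 ≤ (hi α - s) * P * B := by have := sub_nonneg.2 hs.2; positivity
    rw [← hP, ← ENNReal.ofReal_add (by positivity) h1, ← ENNReal.ofReal_add (by positivity) h2]
    refine ENNReal.ofReal_le_ofReal ?_
    rw [← Finset.mul_prod_erase _ _ (Finset.mem_univ α), ← hP, Finset.sum_range_succ']
    have hB' : ∑ i ∈ Finset.range r, 2 * ρ / A (l + (i + 1)) = B :=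
      Finset.sum_congr rfl fun i _ => by rw [add_assoc, add_comm 1 i]
    rw [hB', add_zero]
    have h3 : 2 * ρ ≤ (hi α - lo α) * (2 * ρ / A l) := by
      rw [mul_div_assoc', le_div_iff₀ (hA l)]
      nlinarith
    nlinarith [mul_le_mul_of_nonneg_right h3 hP0]

end SidesOK

/-! ### Masses under the uniform distribution on the cube. -/

section Uniform

variable {d : ℕ}

theorem measurableSet_unitCube (d : ℕ) : MeasurableSet (unitCube d) :=
  measurableSet_coordBox _ fun _ => measurableSet_Icc

theorem uniformCube_nearSplit_le {n r : ℕ} {ρ : ℝ} (hρ : 0 ≤ ρ) {A : ℕ → ℝ}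
    (hA : ∀ l, 0 < A l) {T : KDTree n d} (hT : SidesOK A T 0 (fun _ => 0) (fun _ => 1))
    (hr : T.depth ≤ r) :
    uniformCube d (nearSplit ρ T) ≤ ENNReal.ofReal (∑ i ∈ Finset.range r, 2 * ρ / A i) := by
  rw [uniformCube, Measure.restrict_apply' (measurableSet_unitCube d), Set.inter_comm]
  have := volume_coordIcc_inter_nearSplit_le hρ hA T 0 r _ _ (fun _ => zero_le_one) hT hr
  simpa [unitCube] using this

theorem uniformCube_real_of_subset {s : Set (EuclideanSpace ℝ (Fin d))} (hs : s ⊆ unitCube d) :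
    (uniformCube d).real s = volume.real s := by
  rw [Measure.real, uniformCube, Measure.restrict_apply' (measurableSet_unitCube d),
    Set.inter_eq_left.2 hs, Measure.real]

theorem uniformCube_real_coordIcc {lo hi : Fin d → ℝ} (h : ∀ j, lo j ≤ hi j)
    (hlo : ∀ j, 0 ≤ lo j) (hhi : ∀ j, hi j ≤ 1) :
    (uniformCube d).real {x | ∀ j, x j ∈ Set.Icc (lo j) (hi j)} = ∏ j, (hi j - lo j) := by
  rw [uniformCube_real_of_subset fun x hx j =>
    ⟨(hlo j).trans (hx j).1, (hx j).2.trans (hhi j)⟩, Measure.real, volume_coordIcc h,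
    ENNReal.toReal_ofReal (Finset.prod_nonneg fun j _ => sub_nonneg.2 (h j))]

theorem uniformCube_real_coordIoo {lo hi : Fin d → ℝ} (h : ∀ j, lo j ≤ hi j)
    (hlo : ∀ j, 0 ≤ lo j) (hhi : ∀ j, hi j ≤ 1) :
    (uniformCube d).real {x | ∀ j, x j ∈ Set.Ioo (lo j) (hi j)} = ∏ j, (hi j - lo j) := by
  rw [uniformCube_real_of_subset fun x hx j =>
    ⟨(hlo j).trans (hx j).1.le, (hx j).2.le.trans (hhi j)⟩, Measure.real,
    volume_coordBox _ fun j => measurableSet_Ioo, ENNReal.toReal_prod]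
  refine Finset.prod_congr rfl fun j _ => ?_
  rw [Real.volume_Ioo, ENNReal.toReal_ofReal (sub_nonneg.2 (h j))]

theorem pow_le_uniformCube_real_coordBall {q : EuclideanSpace ℝ (Fin d)} (hq : q ∈ unitCube d)
    {t : ℝ} (ht0 : 0 ≤ t) (ht1 : t ≤ 1) :
    t ^ d ≤ (uniformCube d).real {x | ∀ j, |x j - q j| ≤ t} := by
  have hsub : {x : EuclideanSpace ℝ (Fin d) |
      ∀ j, x j ∈ Set.Icc (max (q j - t) 0) (min (q j + t) 1)} ⊆ {x | ∀ j, |x j - q j| ≤ t} := by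
    intro x hx j
    obtain ⟨h1, h2⟩ := hx j
    rw [abs_le]
    exact ⟨by linarith [(le_max_left _ _).trans h1], by linarith [h2.trans (min_le_left _ _)]⟩
  -- Clipping `[q j - t, q j + t]` to `[0, 1]` leaves length at least `t`, as `t ≤ 1`: at most half
  -- is lost at a single face.
  have hlen : ∀ j, t ≤ min (q j + t) 1 - max (q j - t) 0 := by
    intro j
    obtain ⟨h1, h2⟩ := hq j
    rcases min_cases (q j + t) 1 with h | h <;> rcases max_cases (q j - t) 0 with h' | h' <;>
      rw [h.1, h'.1] <;> linarith
  have hmono : (uniformCube d).real {x : EuclideanSpace ℝ (Fin d) |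
      ∀ j, x j ∈ Set.Icc (max (q j - t) 0) (min (q j + t) 1)} ≤
      (uniformCube d).real {x | ∀ j, |x j - q j| ≤ t} := measureReal_mono hsub
  refine le_trans ?_ hmono
  rw [uniformCube_real_coordIcc (fun j => by linarith [hlen j]) (fun j => le_max_right _ _)
    (fun j => min_le_right _ _)]
  calc t ^ d = ∏ _j : Fin d, t := by simp
    _ ≤ _ := Finset.prod_le_prod (fun _ _ => ht0) fun j _ => hlen j

theorem norm_sub_le_of_coord {x q : EuclideanSpace ℝ (Fin d)} {t : ℝ} (ht : 0 ≤ t)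
    (h : ∀ j, |x j - q j| ≤ t) : ‖x - q‖ ≤ √d * t := by
  rw [EuclideanSpace.norm_eq]
  refine Real.sqrt_le_iff.2 ⟨by positivity, ?_⟩
  rw [mul_pow, Real.sq_sqrt (Nat.cast_nonneg d)]
  calc ∑ i, ‖(x - q) i‖ ^ 2 ≤ ∑ _i : Fin d, t ^ 2 := Finset.sum_le_sum fun i _ => by
        have := h i
        rw [PiLp.sub_apply, Real.norm_eq_abs]
        gcongr
    _ = d * t ^ 2 := by simp

end Uniform

/-! ### Chernoff bounds for the number of data points in a fixed set. -/

section Chernoff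

theorem exp_mul_ncard {E : Type*} {n : ℕ} (D : Set E) (θ : ℝ) (p : Fin n → E) :
    Real.exp (θ * ({i | p i ∈ D}.ncard : ℝ)) =
      ∏ i, (1 + D.indicator (fun _ => Real.exp θ - 1) (p i)) := by
  classical
  have h1 : ∀ i, 1 + D.indicator (fun _ => Real.exp θ - 1) (p i) =
      Real.exp (if p i ∈ D then θ else 0) := by
    intro i
    by_cases h : p i ∈ D <;> simp [h]
  simp_rw [h1]
  rw [← Real.exp_sum, Finset.sum_ite, Set.ncard_eq_toFinset_card']
  simp [mul_comm]

variable {E : Type*} [MeasurableSpace E] (ν : Measure E) [IsProbabilityMeasure ν]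

/-- Markov's inequality for `exp (θ * count)`, which is a product over independent points. Keeping
`θ` on both sides of the event lets one statement serve both tails, according to the sign of `θ`. -/
theorem pi_real_le_exp_of_count {D : Set E} (hD : MeasurableSet D) (n : ℕ) (θ m : ℝ) :
    (Measure.pi fun _ : Fin n => ν).real {p | θ * m ≤ θ * ({i | p i ∈ D}.ncard : ℝ)} ≤
      Real.exp (-(θ * m) + n * ν.real D * (Real.exp θ - 1)) := by
  have hind : Integrable (fun x => 1 + D.indicator (fun _ => Real.exp θ - 1) x) ν :=
    (integrable_const _).add ((integrable_const _).indicator hD)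
  have hint : Integrable (fun p : Fin n → E => Real.exp (1 * (θ * ({i | p i ∈ D}.ncard : ℝ))))
      (Measure.pi fun _ : Fin n => ν) := by
    simp_rw [one_mul, exp_mul_ncard]
    exact Integrable.fintype_prod (f := fun _ x => 1 + D.indicator (fun _ => Real.exp θ - 1) x)
      fun _ => hind
  have hmain := ProbabilityTheory.measure_ge_le_exp_mul_mgf
    (μ := Measure.pi fun _ : Fin n => ν)
    (X := fun p : Fin n → E => θ * ({i | p i ∈ D}.ncard : ℝ)) (θ * m) zero_le_one hint
  refine hmain.trans ?_
  rw [Real.exp_add, neg_one_mul]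
  refine mul_le_mul_of_nonneg_left ?_ (Real.exp_pos _).le
  rw [ProbabilityTheory.mgf]
  simp_rw [one_mul, exp_mul_ncard]
  rw [integral_fintype_prod_eq_pow (fun x => 1 + D.indicator (fun _ => Real.exp θ - 1) x),
    Fintype.card_fin, integral_add (integrable_const _) ((integrable_const _).indicator hD),
    integral_indicator_const _ hD]
  simp only [integral_const, probReal_univ, smul_eq_mul, mul_one]
  rw [mul_assoc, Real.exp_nat_mul]
  have hv : ν.real D ≤ 1 := measureReal_le_one
  have hv0 : 0 ≤ ν.real D := measureReal_nonneg
  refine pow_le_pow_left₀ ?_ ?_ n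
  · nlinarith [Real.exp_pos θ]
  · linarith [Real.add_one_le_exp (ν.real D * (Real.exp θ - 1))]

theorem pi_real_le_count_le {D : Set E} (hD : MeasurableSet D) (n : ℕ) {m δ : ℝ} (hm : 0 ≤ m)
    (hδ0 : 0 ≤ δ) (hδ1 : δ ≤ 1) (hv : n * ν.real D ≤ (1 - δ) * m) :
    (Measure.pi fun _ : Fin n => ν).real {p | m ≤ ({i | p i ∈ D}.ncard : ℝ)} ≤
      Real.exp (-(m * δ ^ 2 / 8)) := by
  -- With `θ = δ / 2` and `exp θ - 1 ≤ θ + θ ^ 2`, the exponent is at most `-(m * δ ^ 2 + m * δ ^ 3)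
  -- / 4`.
  have h := pi_real_le_exp_of_count ν hD n (δ / 2) m
  have hsub : {p : Fin n → E | m ≤ ({i | p i ∈ D}.ncard : ℝ)} ⊆
      {p | δ / 2 * m ≤ δ / 2 * ({i | p i ∈ D}.ncard : ℝ)} := fun p hp =>
    mul_le_mul_of_nonneg_left (Set.mem_ofPred.1 hp) (by positivity)
  refine (measureReal_mono hsub).trans (h.trans (Real.exp_le_exp.2 ?_))
  have he := (abs_le.1 (Real.abs_exp_sub_one_sub_id_le (x := δ / 2)
    (by rw [abs_of_nonneg (by positivity)]; linarith))).2
  have he0 : 0 ≤ Real.exp (δ / 2) - 1 := by linarith [Real.add_one_le_exp (δ / 2)]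
  have h1 : n * ν.real D * (Real.exp (δ / 2) - 1) ≤ (1 - δ) * m * (δ / 2 + (δ / 2) ^ 2) := by
    refine (mul_le_mul_of_nonneg_right hv he0).trans ?_
    refine mul_le_mul_of_nonneg_left (by linarith) ?_
    have : 0 ≤ 1 - δ := by linarith
    positivity
  have h2 : 0 ≤ m * δ ^ 2 := by positivity
  have h3 : 0 ≤ m * δ ^ 3 := by positivity
  nlinarith

theorem pi_real_count_le_le {D : Set E} (hD : MeasurableSet D) (n : ℕ) {m δ : ℝ} (hm : 0 ≤ m)
    (hδ0 : 0 ≤ δ) (hδ1 : δ ≤ 1) (hv : (1 + δ) * m ≤ n * ν.real D) :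
    (Measure.pi fun _ : Fin n => ν).real {p | ({i | p i ∈ D}.ncard : ℝ) ≤ m} ≤
      Real.exp (-(m * δ ^ 2 / 8)) := by
  -- Here the exponent is at most `m * (δ ^ 3 - 3 * δ ^ 2) / 16`, which is at most `-(m * δ ^ 2 /
  -- 8)` since `δ ≤ 1`.
  have h := pi_real_le_exp_of_count ν hD n (-(δ / 4)) m
  have hsub : {p : Fin n → E | ({i | p i ∈ D}.ncard : ℝ) ≤ m} ⊆
      {p | -(δ / 4) * m ≤ -(δ / 4) * ({i | p i ∈ D}.ncard : ℝ)} := fun p hp =>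
    mul_le_mul_of_nonpos_left (Set.mem_ofPred.1 hp) (by linarith)
  refine (measureReal_mono hsub).trans (h.trans (Real.exp_le_exp.2 ?_))
  have he := (abs_le.1 (Real.abs_exp_sub_one_sub_id_le (x := -(δ / 4))
    (by rw [abs_of_nonpos (by linarith)]; linarith))).2
  have he0 : Real.exp (-(δ / 4)) - 1 ≤ 0 := by
    have : Real.exp (-(δ / 4)) ≤ 1 := Real.exp_le_one_iff.2 (by linarith)
    linarith
  have h1 : n * ν.real D * (Real.exp (-(δ / 4)) - 1) ≤
      (1 + δ) * m * (-(δ / 4) + (-(δ / 4)) ^ 2) := by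
    refine (mul_le_mul_of_nonpos_right hv he0).trans ?_
    exact mul_le_mul_of_nonneg_left (by linarith) (by positivity)
  have h2 : 0 ≤ m * δ ^ 2 := by positivity
  have h3 : m * δ ^ 3 ≤ m * δ ^ 2 := by
    refine mul_le_mul_of_nonneg_left ?_ hm
    nlinarith [sq_nonneg δ]
  nlinarith

end Chernoff

/-! ### Almost surely the data have no coordinate ties and lie in the cube. -/

section AlmostEverywhere

theorem pi_uniformCube_absolutelyContinuous (n d : ℕ) :
    (Measure.pi fun _ : Fin n => uniformCube d) ≪
      (volume : Measure (Fin n → EuclideanSpace ℝ (Fin d))) := by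
  have : (Measure.pi fun _ : Fin n => uniformCube d) =
      (volume : Measure (Fin n → EuclideanSpace ℝ (Fin d))).restrict
        (Set.univ.pi fun _ => unitCube d) := by
    rw [volume_pi, Measure.restrict_pi_pi]
    rfl
  rw [this]
  exact Measure.restrict_le_self.absolutelyContinuous

theorem ae_injective_coord (n d : ℕ) (α : Fin d) :
    ∀ᵐ p ∂(Measure.pi fun _ : Fin n => uniformCube d), Function.Injective fun i => p i α := by
  have hne : ∀ i j : Fin n, i ≠ j →
      ∀ᵐ p ∂(Measure.pi fun _ : Fin n => uniformCube d), p i α ≠ p j α := by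
    intro i j hij
    let f : (Fin n → EuclideanSpace ℝ (Fin d)) →ₗ[ℝ] ℝ :=
      { toFun := fun p => p i α - p j α
        map_add' := fun p q => by simp; ring
        map_smul' := fun c p => by simp; ring }
    refine (pi_uniformCube_absolutelyContinuous n d).ae_le ?_
    -- A tie is the vanishing of a nonzero linear functional, that is, membership in a proper
    -- subspace, which is Lebesgue null.
    have hker : LinearMap.ker f ≠ ⊤ := by
      intro htop
      have h0 : Pi.single i (EuclideanSpace.single α (1 : ℝ)) ∈ LinearMap.ker f := by
        rw [htop]; trivial
      have h1 : (Pi.single i (EuclideanSpace.single α (1 : ℝ)) :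
          Fin n → EuclideanSpace ℝ (Fin d)) i α -
          (Pi.single i (EuclideanSpace.single α (1 : ℝ)) :
          Fin n → EuclideanSpace ℝ (Fin d)) j α = 0 := h0
      rw [Pi.single_eq_same, Pi.single_eq_of_ne hij.symm] at h1
      simp at h1
    have h0 := Measure.addHaar_submodule
      (volume : Measure (Fin n → EuclideanSpace ℝ (Fin d))) _ hker
    rw [← Filter.eventually_iff, ae_iff]
    refine measure_mono_null (fun p hp => ?_) h0
    have hp' : p i α = p j α := not_not.1 hp
    exact sub_eq_zero.2 hp'
  have hall : ∀ᵐ p ∂(Measure.pi fun _ : Fin n => uniformCube d),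
      ∀ i j : Fin n, i ≠ j → p i α ≠ p j α := by
    rw [ae_all_iff]; intro i
    rw [ae_all_iff]; intro j
    by_cases hij : i = j
    · exact Filter.Eventually.of_forall fun _ h => (h hij).elim
    · filter_upwards [hne i j hij] with p hp _ using hp
  filter_upwards [hall] with p hp i j hij
  by_contra h
  exact hp i j h hij

theorem ae_mem_unitCube (n d : ℕ) :
    ∀ᵐ p ∂(Measure.pi fun _ : Fin n => uniformCube d), ∀ i, p i ∈ unitCube d := by
  rw [ae_all_iff]
  intro i
  have h : ∀ᵐ x ∂(uniformCube d), x ∈ unitCube d := ae_restrict_mem (measurableSet_unitCube d)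
  exact (Measure.tendsto_eval_ae_ae (μ := fun _ : Fin n => uniformCube d) (i := i)).eventually h

end AlmostEverywhere

/-! ### Conditioning on the data or on the query. -/

section Product

/-- The exceptional set `A` of data need not be measurable: its measurable hull has the same
measure. This spares a measurability proof for `GridRegular`. -/
theorem prod_measure_le_add {X Y : Type*} [MeasurableSpace X] [MeasurableSpace Y]
    (μ : Measure X) (ν : Measure Y) [IsProbabilityMeasure μ] [IsProbabilityMeasure ν]
    {N : Set (X × Y)} (hN : MeasurableSet N) (A : Set X) {b : ENNReal}
    (h : ∀ x, x ∉ A → ν (Prod.mk x ⁻¹' N) ≤ b) : μ.prod ν N ≤ μ A + b := by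
  rw [Measure.prod_apply hN]
  calc ∫⁻ x, ν (Prod.mk x ⁻¹' N) ∂μ
      ≤ ∫⁻ x, (toMeasurable μ A).indicator 1 x + b ∂μ := by
        refine lintegral_mono fun x => ?_
        by_cases hx : x ∈ toMeasurable μ A
        · simp only [Set.indicator_of_mem hx, Pi.one_apply]
          exact prob_le_one.trans le_self_add
        · simp only [Set.indicator_of_notMem hx, zero_add]
          exact h x fun hxA => hx (subset_toMeasurable μ A hxA)
    _ = μ A + b := by
        rw [lintegral_add_right _ measurable_const, lintegral_const, measure_univ, mul_one,
          lintegral_indicator_one (measurableSet_toMeasurable μ A), measure_toMeasurable]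

theorem dataQueryLaw_no_data_near_le (n d : ℕ) {t : ℝ} (ht0 : 0 ≤ t) (ht1 : t ≤ 1) :
    dataQueryLaw n d {ω | ∀ i, ¬ ∀ j, |ω.1 i j - ω.2 j| ≤ t} ≤
      ENNReal.ofReal (Real.exp (-(n * t ^ d))) := by
  have hm1 : MeasurableSet {ω : (Fin n → EuclideanSpace ℝ (Fin d)) × EuclideanSpace ℝ (Fin d) |
      ∀ i, ¬ ∀ j, |ω.1 i j - ω.2 j| ≤ t} := by
    have : {ω : (Fin n → EuclideanSpace ℝ (Fin d)) × EuclideanSpace ℝ (Fin d) |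
        ∀ i, ¬ ∀ j, |ω.1 i j - ω.2 j| ≤ t} =
        ⋂ i, (⋂ j, {ω | |ω.1 i j - ω.2 j| ≤ t})ᶜ := by
      ext ω; simp
    rw [this]
    refine MeasurableSet.iInter fun i => (MeasurableSet.iInter fun j => ?_).compl
    refine measurableSet_le (Measurable.abs (Measurable.sub ?_ ?_)) measurable_const <;> fun_prop
  rw [dataQueryLaw, Measure.prod_apply_symm hm1]
  have hq : ∀ᵐ q ∂(uniformCube d), q ∈ unitCube d := ae_restrict_mem (measurableSet_unitCube d)
  calc ∫⁻ q, (Measure.pi fun _ : Fin n => uniformCube d) ((fun p => (p, q)) ⁻¹'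
        {ω | ∀ i, ¬ ∀ j, |ω.1 i j - ω.2 j| ≤ t}) ∂(uniformCube d)
      ≤ ∫⁻ _, ENNReal.ofReal (Real.exp (-(n * t ^ d))) ∂(uniformCube d) := by
        refine lintegral_mono_ae ?_
        filter_upwards [hq] with q hq
        have hset : (fun p : Fin n → EuclideanSpace ℝ (Fin d) => (p, q)) ⁻¹'
            {ω | ∀ i, ¬ ∀ j, |ω.1 i j - ω.2 j| ≤ t} =
            Set.univ.pi fun _ => {x | ∀ j, |x j - q j| ≤ t}ᶜ := by
          ext p; simp
        have hD : MeasurableSet {x : EuclideanSpace ℝ (Fin d) | ∀ j, |x j - q j| ≤ t} := by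
          have : {x : EuclideanSpace ℝ (Fin d) | ∀ j, |x j - q j| ≤ t} =
              ⋂ j, {x | |x j - q j| ≤ t} := by
            ext; simp
          rw [this]
          refine MeasurableSet.iInter fun j => ?_
          refine measurableSet_le (Measurable.abs (Measurable.sub ?_ ?_)) measurable_const <;>
            fun_prop
        have hv := pow_le_uniformCube_real_coordBall hq ht0 ht1
        rw [hset, Measure.pi_pi, Finset.prod_const, Finset.card_univ, Fintype.card_fin,
          ← ofReal_measureReal, ← ENNReal.ofReal_pow measureReal_nonneg,
          probReal_compl_eq_one_sub hD]
        refine ENNReal.ofReal_le_ofReal ?_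
        rw [← mul_neg, Real.exp_nat_mul]
        have hv1 : (uniformCube d).real {x | ∀ j, |x j - q j| ≤ t} ≤ 1 := measureReal_le_one
        refine pow_le_pow_left₀ (by linarith) ?_ n
        linarith [Real.add_one_le_exp (-t ^ d)]
    _ = _ := by simp

end Product

/-! ### How often each coordinate has been split. -/

section SplitCount

variable {d : ℕ} [NeZero d]

/-- The number of levels before level `l` at which coordinate `j` is split. -/
def splitCount (d : ℕ) [NeZero d] (l : ℕ) (j : Fin d) : ℕ :=
  ((Finset.range l).filter (fun i => splitCoord d i = j)).card

theorem splitCount_zero (j : Fin d) : splitCount d 0 j = 0 := by simp [splitCount]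

theorem splitCount_succ_of_ne {l : ℕ} {j : Fin d} (h : j ≠ splitCoord d l) :
    splitCount d (l + 1) j = splitCount d l j := by
  rw [splitCount, Finset.range_add_one, Finset.filter_insert, if_neg h.symm, splitCount]

theorem sum_splitCount (l : ℕ) : ∑ j, splitCount d l j = l := by
  have h := Finset.card_eq_sum_card_fiberwise (s := Finset.range l) (t := Finset.univ)
    (f := splitCoord d) (fun _ _ => Finset.mem_coe.2 (Finset.mem_univ _))
  rw [Finset.card_range] at h
  exact h.symm

theorem splitCount_splitCoord (l : ℕ) : splitCount d l (splitCoord d l) = l / d := by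
  have hd := NeZero.pos d
  have h := Nat.count_modEq_card l hd l
  rw [if_neg (lt_irrefl _), add_zero] at h
  rw [← h, Nat.count_eq_card_filter_range, splitCount]
  congr 1
  refine Finset.filter_congr fun i _ => ?_
  rw [splitCoord, splitCoord, Fin.mk.injEq, Nat.ModEq]

end SplitCount

/-! ### A deterministic grid and uniform control of the counts in its boxes. -/

section Grid

variable {n d : ℕ} [NeZero d]

/-- The point with index `a` of the grid of the `j`-th axis at level `l`. -/
noncomputable def gridPoint (d : ℕ) [NeZero d] (M l : ℕ) (a : Fin d → ℕ) (j : Fin d) : ℝ :=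
  a j / (2 ^ splitCount d l j * M)

/-- At each level `l ≤ k`, the closed grid boxes with at least `n₀ 2 ^ (k - l)` points have volume
at least `(1 - δ l) 2 ^ (-l)`, and the open grid boxes with at most so many points have volume at
most `(1 + δ l) 2 ^ (-l)`. -/
def GridRegular (n₀ k M : ℕ) (δ : ℕ → ℝ) (p : Fin n → EuclideanSpace ℝ (Fin d)) : Prop :=
  ∀ l ≤ k, ∀ a b : Fin d → ℕ, (∀ j, a j ≤ b j) → (∀ j, b j ≤ 2 ^ splitCount d l j * M) →
    (n₀ * 2 ^ (k - l) ≤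
        {i | p i ∈ {x | ∀ j, x j ∈ Set.Icc (gridPoint d M l a j) (gridPoint d M l b j)}}.ncard →
      1 - δ l ≤ ∏ j, ((b j : ℝ) - a j) / M) ∧
    ({i | p i ∈ {x | ∀ j, x j ∈ Set.Ioo (gridPoint d M l a j) (gridPoint d M l b j)}}.ncard ≤
        n₀ * 2 ^ (k - l) →
      ∏ j, ((b j : ℝ) - a j) / M ≤ 1 + δ l)

theorem gridPoint_nonneg (M l : ℕ) (a : Fin d → ℕ) (j : Fin d) : 0 ≤ gridPoint d M l a j := by
  rw [gridPoint]; positivity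

theorem gridPoint_le_one {M l : ℕ} {a : Fin d → ℕ} {j : Fin d}
    (h : a j ≤ 2 ^ splitCount d l j * M) : gridPoint d M l a j ≤ 1 := by
  rw [gridPoint]
  exact div_le_one_of_le₀ (by exact_mod_cast h) (by positivity)

theorem gridPoint_mono {M l : ℕ} {a b : Fin d → ℕ} {j : Fin d} (h : a j ≤ b j) :
    gridPoint d M l a j ≤ gridPoint d M l b j := by
  rw [gridPoint, gridPoint]
  gcongr

/-- The mesh on axis `j` is finer by the factor `2 ^ splitCount d l j`; these factors multiply to `2
^ l`, so the remaining product is the volume relative to an ideal cell of level `l`. -/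
theorem prod_gridPoint_sub (M l : ℕ) (a b : Fin d → ℕ) :
    ∏ j, (gridPoint d M l b j - gridPoint d M l a j) =
      (∏ j, ((b j : ℝ) - a j) / M) / 2 ^ l := by
  have h : (2 : ℝ) ^ l = ∏ j, 2 ^ splitCount d l j := by
    rw [Finset.prod_pow_eq_pow_sum, sum_splitCount]
  rw [h, ← Finset.prod_div_distrib]
  refine Finset.prod_congr rfl fun j _ => ?_
  rw [gridPoint, gridPoint, ← sub_div, div_div, mul_comm]

theorem card_gridIndices_le {M : ℕ} (hM : 1 ≤ M) (l : ℕ) :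
    (Fintype.piFinset fun j : Fin d => Finset.range (2 ^ splitCount d l j * M + 1)).card ≤
      2 ^ l * (2 * M) ^ d := by
  rw [Fintype.card_piFinset]
  have h : (2 : ℕ) ^ l = ∏ j, 2 ^ splitCount d l j := by
    rw [Finset.prod_pow_eq_pow_sum, sum_splitCount]
  have h' : (2 * M) ^ d = ∏ _j : Fin d, (2 * M) := by simp
  rw [h, h', ← Finset.prod_mul_distrib]
  refine Finset.prod_le_prod' fun j _ => ?_
  rw [Finset.card_range]
  have : 1 ≤ 2 ^ splitCount d l j * M := Nat.mul_pos (by positivity) hM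
  nlinarith

/-- A grid box of relative volume `x` has expected count `x * (n₀ * 2 ^ (k - l))`, so each violation
is a Chernoff tail at `m = n₀ * 2 ^ (k - l)`. The union bound runs over `k + 1` levels and all pairs
of corners, with one upper and one lower tail for each. -/
theorem pi_real_not_gridRegular_le {n₀ k M : ℕ} (hn : n = n₀ * 2 ^ k) (hM : 1 ≤ M) {δ : ℕ → ℝ}
    (hδ0 : ∀ l, 0 ≤ δ l) (hδ1 : ∀ l ≤ k, δ l ≤ 1) {e : ℝ}
    (he : ∀ l ≤ k, e ≤ (n₀ * 2 ^ (k - l) : ℕ) * δ l ^ 2 / 8) :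
    (Measure.pi fun _ : Fin n => uniformCube d).real {p | ¬ GridRegular n₀ k M δ p} ≤
      (k + 1) * (4 ^ k * (2 * M) ^ (2 * d)) * (2 * Real.exp (-e)) := by
  set μ := Measure.pi fun _ : Fin n => uniformCube d with hμ
  have : IsProbabilityMeasure μ := by rw [hμ]; infer_instance
  let I : ℕ → Finset (Fin d → ℕ) := fun l =>
    Fintype.piFinset fun j : Fin d => Finset.range (2 ^ splitCount d l j * M + 1)
  let U : ℕ → (Fin d → ℕ) × (Fin d → ℕ) → Set (Fin n → EuclideanSpace ℝ (Fin d)) := fun l ab =>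
    {p | (∀ j, ab.1 j ≤ ab.2 j) ∧ n₀ * 2 ^ (k - l) ≤ {i | p i ∈ {x | ∀ j, x j ∈
      Set.Icc (gridPoint d M l ab.1 j) (gridPoint d M l ab.2 j)}}.ncard ∧
      ¬ 1 - δ l ≤ ∏ j, ((ab.2 j : ℝ) - ab.1 j) / M}
  let V : ℕ → (Fin d → ℕ) × (Fin d → ℕ) → Set (Fin n → EuclideanSpace ℝ (Fin d)) := fun l ab =>
    {p | (∀ j, ab.1 j ≤ ab.2 j) ∧ {i | p i ∈ {x | ∀ j, x j ∈
      Set.Ioo (gridPoint d M l ab.1 j) (gridPoint d M l ab.2 j)}}.ncard ≤ n₀ * 2 ^ (k - l) ∧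
      ¬ ∏ j, ((ab.2 j : ℝ) - ab.1 j) / M ≤ 1 + δ l}
  have hsub : {p | ¬ GridRegular n₀ k M δ p} ⊆
      ⋃ l ∈ Finset.range (k + 1), ⋃ ab ∈ I l ×ˢ I l, (U l ab ∪ V l ab) := by
    intro p hp
    simp only [Set.mem_ofPred_eq, GridRegular, not_forall, exists_prop] at hp
    obtain ⟨l, hl, a, b, hab, hb, hbad⟩ := hp
    simp only [Set.mem_iUnion, exists_prop]
    refine ⟨l, Finset.mem_range.2 (by omega), (a, b), ?_, ?_⟩
    · simp only [I, Finset.mem_product, Fintype.mem_piFinset, Finset.mem_range]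
      exact ⟨fun j => by have := hab j; have := hb j; omega, fun j => by have := hb j; omega⟩
    · by_cases h1 : n₀ * 2 ^ (k - l) ≤ {i | p i ∈ {x | ∀ j, x j ∈
          Set.Icc (gridPoint d M l a j) (gridPoint d M l b j)}}.ncard ∧
          ¬ 1 - δ l ≤ ∏ j, ((b j : ℝ) - a j) / M
      · exact Or.inl ⟨hab, h1⟩
      · refine Or.inr ⟨hab, ?_⟩
        by_contra h2
        exact hbad ⟨fun h => by_contra fun h' => h1 ⟨h, h'⟩,
          fun h => by_contra fun h' => h2 ⟨h, h'⟩⟩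
  have hvol : ∀ l ≤ k, ∀ x : ℝ, (n : ℝ) * (x / 2 ^ l) = x * (n₀ * 2 ^ (k - l) : ℕ) := by
    intro l hl x
    have h2 : (2 : ℝ) ^ k = 2 ^ (k - l) * 2 ^ l := by rw [← pow_add, Nat.sub_add_cancel hl]
    rw [hn]
    push_cast
    rw [h2]
    field_simp
  have hUV : ∀ l ∈ Finset.range (k + 1), ∀ ab ∈ I l ×ˢ I l,
      μ.real (U l ab ∪ V l ab) ≤ 2 * Real.exp (-e) := by
    intro l hl ab hab
    have hl' : l ≤ k := Nat.lt_succ_iff.1 (Finset.mem_range.1 hl)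
    have hb : ∀ j, ab.2 j ≤ 2 ^ splitCount d l j * M := fun j => by
      have := (Fintype.mem_piFinset.1 (Finset.mem_product.1 hab).2) j
      rw [Finset.mem_range] at this
      omega
    have hexp : Real.exp (-((n₀ * 2 ^ (k - l) : ℕ) * δ l ^ 2 / 8)) ≤ Real.exp (-e) :=
      Real.exp_le_exp.2 (neg_le_neg (he l hl'))
    have hU : μ.real (U l ab) ≤ Real.exp (-e) := by
      by_cases hc : (∀ j, ab.1 j ≤ ab.2 j) ∧ ¬ 1 - δ l ≤ ∏ j, ((ab.2 j : ℝ) - ab.1 j) / M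
      · refine le_trans ?_ ((pi_real_le_count_le (uniformCube d) (measurableSet_coordBox _
          fun j => measurableSet_Icc (a := gridPoint d M l ab.1 j) (b := gridPoint d M l ab.2 j))
          n (Nat.cast_nonneg (n₀ * 2 ^ (k - l))) (hδ0 l) (hδ1 l hl') ?_).trans hexp)
        · refine measureReal_mono fun p hp => ?_
          exact Set.mem_ofPred.2 (Nat.cast_le.2 hp.2.1)
        · rw [uniformCube_real_coordIcc (fun j => gridPoint_mono (hc.1 j))
            (fun j => gridPoint_nonneg _ _ _ _) (fun j => gridPoint_le_one (hb j)),
            prod_gridPoint_sub, hvol l hl']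
          exact mul_le_mul_of_nonneg_right (not_le.1 hc.2).le (Nat.cast_nonneg _)
      · have : U l ab = ∅ := Set.eq_empty_of_forall_notMem fun p hp => hc ⟨hp.1, hp.2.2⟩
        rw [this, measureReal_empty]
        exact (Real.exp_pos _).le
    have hV : μ.real (V l ab) ≤ Real.exp (-e) := by
      by_cases hc : (∀ j, ab.1 j ≤ ab.2 j) ∧ ¬ ∏ j, ((ab.2 j : ℝ) - ab.1 j) / M ≤ 1 + δ l
      · refine le_trans ?_ ((pi_real_count_le_le (uniformCube d) (measurableSet_coordBox _
          fun j => measurableSet_Ioo (a := gridPoint d M l ab.1 j) (b := gridPoint d M l ab.2 j))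
          n (Nat.cast_nonneg (n₀ * 2 ^ (k - l))) (hδ0 l) (hδ1 l hl') ?_).trans hexp)
        · refine measureReal_mono fun p hp => ?_
          exact Set.mem_ofPred.2 (Nat.cast_le.2 hp.2.1)
        · rw [uniformCube_real_coordIoo (fun j => gridPoint_mono (hc.1 j))
            (fun j => gridPoint_nonneg _ _ _ _) (fun j => gridPoint_le_one (hb j)),
            prod_gridPoint_sub, hvol l hl']
          exact mul_le_mul_of_nonneg_right (not_le.1 hc.2).le (Nat.cast_nonneg _)
      · have : V l ab = ∅ := Set.eq_empty_of_forall_notMem fun p hp => hc ⟨hp.1, hp.2.2⟩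
        rw [this, measureReal_empty]
        exact (Real.exp_pos _).le
    calc μ.real (U l ab ∪ V l ab) ≤ μ.real (U l ab) + μ.real (V l ab) :=
          measureReal_union_le _ _
      _ ≤ 2 * Real.exp (-e) := by linarith
  have hcard : ∀ l ∈ Finset.range (k + 1),
      ((I l ×ˢ I l).card : ℝ) ≤ 4 ^ k * (2 * M) ^ (2 * d) := by
    intro l hl
    have hl' : l ≤ k := Nat.lt_succ_iff.1 (Finset.mem_range.1 hl)
    have h := card_gridIndices_le (d := d) hM l
    have h2 : (I l ×ˢ I l).card ≤ 4 ^ k * (2 * M) ^ (2 * d) := by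
      rw [Finset.card_product]
      calc (I l).card * (I l).card ≤ (2 ^ l * (2 * M) ^ d) * (2 ^ l * (2 * M) ^ d) :=
            Nat.mul_le_mul h h
        _ = 4 ^ l * (2 * M) ^ (2 * d) := by
            have h4 : (4 : ℕ) ^ l = 2 ^ l * 2 ^ l := by rw [← mul_pow]; norm_num
            rw [h4, two_mul d, pow_add]
            ring
        _ ≤ _ := Nat.mul_le_mul_right _ (Nat.pow_le_pow_right (by norm_num) hl')
    exact_mod_cast h2
  calc μ.real {p | ¬ GridRegular n₀ k M δ p}
      ≤ μ.real (⋃ l ∈ Finset.range (k + 1), ⋃ ab ∈ I l ×ˢ I l, (U l ab ∪ V l ab)) :=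
        measureReal_mono hsub (measure_ne_top μ _)
    _ ≤ ∑ l ∈ Finset.range (k + 1), μ.real (⋃ ab ∈ I l ×ˢ I l, (U l ab ∪ V l ab)) :=
        measureReal_biUnion_finset_le _ _
    _ ≤ ∑ _l ∈ Finset.range (k + 1), (4 ^ k * (2 * M) ^ (2 * d)) * (2 * Real.exp (-e)) := by
        refine Finset.sum_le_sum fun l hl => (measureReal_biUnion_finset_le _ _).trans ?_
        refine (Finset.sum_le_sum (hUV l hl)).trans ?_
        rw [Finset.sum_const, nsmul_eq_mul]
        exact mul_le_mul_of_nonneg_right (hcard l hl) (by positivity)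
    _ = _ := by
        rw [Finset.sum_const, Finset.card_range, nsmul_eq_mul]
        push_cast
        ring

end Grid

/-! ### Cells of the tree remain balanced. -/

section Cells

variable {n d : ℕ} [NeZero d]

/-- The box is rounded outward to the grid, which loses no point and lengthens each rescaled side by
at most `1 / M` at either end. -/
theorem GridRegular.le_prod_outer {n₀ k M : ℕ} {δ : ℕ → ℝ}
    {p : Fin n → EuclideanSpace ℝ (Fin d)} (hp : GridRegular n₀ k M δ p) (hM : 1 ≤ M) {l : ℕ}
    (hl : l ≤ k) {S : Finset (Fin n)} (hS : n₀ * 2 ^ (k - l) ≤ S.card) {lo hi : Fin d → ℝ}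
    (hmem : ∀ i ∈ S, ∀ j, p i j ∈ Set.Icc (lo j) (hi j)) (hlo : ∀ j, 0 ≤ lo j)
    (hhi : ∀ j, hi j ≤ 1) (hlohi : ∀ j, lo j ≤ hi j) :
    1 - δ l ≤ ∏ j, (2 ^ splitCount d l j * (hi j - lo j) + 2 / M) := by
  have hM0 : (0 : ℝ) < M := by exact_mod_cast hM
  let w : Fin d → ℝ := fun j => 2 ^ splitCount d l j * M
  have hw : ∀ j, 0 < w j := fun j => by positivity
  let a : Fin d → ℕ := fun j => ⌊lo j * w j⌋₊
  let b : Fin d → ℕ := fun j => ⌈hi j * w j⌉₊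
  have ha : ∀ j, gridPoint d M l a j ≤ lo j := fun j => by
    rw [gridPoint, div_le_iff₀ (hw j)]
    exact Nat.floor_le (mul_nonneg (hlo j) (hw j).le)
  have hb : ∀ j, hi j ≤ gridPoint d M l b j := fun j => by
    rw [gridPoint, le_div_iff₀ (hw j)]
    exact Nat.le_ceil _
  have hab : ∀ j, a j ≤ b j := fun j =>
    (Nat.floor_le_floor (mul_le_mul_of_nonneg_right (hlohi j) (hw j).le)).trans
      (Nat.floor_le_ceil _)
  have hbw : ∀ j, b j ≤ 2 ^ splitCount d l j * M := fun j => by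
    refine Nat.ceil_le.2 ?_
    push_cast
    exact mul_le_of_le_one_left (hw j).le (hhi j)
  refine ((hp l hl a b hab hbw).1 (hS.trans ?_)).trans ?_
  · rw [← Set.ncard_coe_finset]
    refine Set.ncard_le_ncard (fun i hi' => ?_) (Set.toFinite _)
    intro j
    have := hmem i hi' j
    exact ⟨(ha j).trans this.1, this.2.trans (hb j)⟩
  · refine Finset.prod_le_prod (fun j _ => ?_) fun j _ => ?_
    · have : (a j : ℝ) ≤ b j := by exact_mod_cast hab j
      exact div_nonneg (by linarith) hM0.le
    · have h1 : lo j * w j < a j + 1 := Nat.lt_floor_add_one _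
      have h2 : (b j : ℝ) < hi j * w j + 1 :=
        Nat.ceil_lt_add_one (mul_nonneg ((hlo j).trans (hlohi j)) (hw j).le)
      rw [div_le_iff₀ hM0, add_mul, div_mul_cancel₀ _ hM0.ne']
      have h3 : 2 ^ splitCount d l j * (hi j - lo j) * M = hi j * w j - lo j * w j := by
        simp only [w]; ring
      linarith

/-- The box is rounded inward; `hlohi` keeps the rounded corners in order. Open boxes are needed
because a data point on a splitting hyperplane may belong to the neighbouring cell. -/
theorem GridRegular.prod_inner_le {n₀ k M : ℕ} {δ : ℕ → ℝ}
    {p : Fin n → EuclideanSpace ℝ (Fin d)} (hp : GridRegular n₀ k M δ p) (hM : 1 ≤ M) {l : ℕ}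
    (hl : l ≤ k) {S : Finset (Fin n)} (hS : S.card ≤ n₀ * 2 ^ (k - l)) {lo hi : Fin d → ℝ}
    (hmem : ∀ i, (∀ j, p i j ∈ Set.Ioo (lo j) (hi j)) → i ∈ S) (hlo : ∀ j, 0 ≤ lo j)
    (hhi : ∀ j, hi j ≤ 1) (hlohi : ∀ j, 2 / M ≤ 2 ^ splitCount d l j * (hi j - lo j)) :
    ∏ j, (2 ^ splitCount d l j * (hi j - lo j) - 2 / M) ≤ 1 + δ l := by
  have hM0 : (0 : ℝ) < M := by exact_mod_cast hM
  let w : Fin d → ℝ := fun j => 2 ^ splitCount d l j * M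
  have hw : ∀ j, 0 < w j := fun j => by positivity
  let a : Fin d → ℕ := fun j => ⌈lo j * w j⌉₊
  let b : Fin d → ℕ := fun j => ⌊hi j * w j⌋₊
  have hlen : ∀ j, 2 ≤ hi j * w j - lo j * w j := fun j => by
    have h := (div_le_iff₀ hM0).1 (hlohi j)
    simp only [w]
    linarith
  have hlow : ∀ j, 0 ≤ lo j * w j := fun j => mul_nonneg (hlo j) (hw j).le
  have hhiw : ∀ j, 0 ≤ hi j * w j := fun j => by linarith [hlow j, hlen j]
  have ha : ∀ j, lo j ≤ gridPoint d M l a j := fun j => by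
    rw [gridPoint, le_div_iff₀ (hw j)]
    exact Nat.le_ceil _
  have hb : ∀ j, gridPoint d M l b j ≤ hi j := fun j => by
    rw [gridPoint, div_le_iff₀ (hw j)]
    exact Nat.floor_le (hhiw j)
  have h1 : ∀ j, (a j : ℝ) < lo j * w j + 1 := fun j => Nat.ceil_lt_add_one (hlow j)
  have h2 : ∀ j, hi j * w j < b j + 1 := fun j => Nat.lt_floor_add_one _
  have hab : ∀ j, a j ≤ b j := fun j => by
    have : (a j : ℝ) ≤ b j := by linarith [h1 j, h2 j, hlen j]
    exact_mod_cast this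
  have hbw : ∀ j, b j ≤ 2 ^ splitCount d l j * M := fun j => by
    have h3 : (b j : ℝ) ≤ hi j * w j := Nat.floor_le (hhiw j)
    have h4 : hi j * w j ≤ w j := mul_le_of_le_one_left (hw j).le (hhi j)
    have h5 : (b j : ℝ) ≤ (2 ^ splitCount d l j * M : ℕ) := by
      push_cast
      exact h3.trans h4
    exact_mod_cast h5
  refine le_trans ?_ ((hp l hl a b hab hbw).2 (le_trans ?_ hS))
  · refine Finset.prod_le_prod (fun j _ => sub_nonneg.2 (hlohi j)) fun j _ => ?_
    rw [le_div_iff₀ hM0, sub_mul, div_mul_cancel₀ _ hM0.ne']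
    have h3 : 2 ^ splitCount d l j * (hi j - lo j) * M = hi j * w j - lo j * w j := by
      simp only [w]; ring
    linarith [h1 j, h2 j]
  · rw [← Set.ncard_coe_finset]
    refine Set.ncard_le_ncard (fun i hi' => ?_) (Set.toFinite _)
    refine hmem i fun j => ?_
    have := hi' j
    exact ⟨(ha j).trans_lt this.1, this.2.trans_le (hb j)⟩

/-- A box whose volume (with sides inflated by `η`) is at least about half that of the box it is
cut from (with sides deflated by `η`) has at least about half its side in the direction of the
cut. Here the sides are rescaled, `τ` being twice the new side and `σ` the old sides. -/
theorem side_ge_of_prod_bounds {ι : Type*} [DecidableEq ι] {s : Finset ι} {d : ℕ}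
    (hs : s.card ≤ d) {σ : ι → ℝ} {x τ η δ δ' Γ : ℝ} (hσ : ∀ j ∈ s, 1 / 4 ≤ σ j)
    (hx : 1 / 4 ≤ x) (hτ : 0 ≤ τ) (hη : 0 < η) (hη' : η ≤ 1 / 20) (hδ : 0 ≤ δ) (hδ' : 0 ≤ δ')
    (hδ1 : δ' ≤ 1) (hΓ : 0 ≤ Γ) (hxΓ : 1 - Γ ≤ x)
    (houter : 1 - δ' ≤ (τ + η) * ∏ j ∈ s, (σ j + η))
    (hinner : (x - η) * ∏ j ∈ s, (σ j - η) ≤ 1 + δ) :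
    1 - (Γ + δ + δ' + (8 * d + 2) * η) ≤ τ := by
  set e : ℝ := 8 * d * η with he
  have he0 : 0 ≤ e := by positivity
  -- In this case the claimed lower bound is negative and `0 ≤ τ` suffices.
  by_cases hγ : 1 < e + δ + δ'
  · have : (8 * d + 2) * η = e + 2 * η := by rw [he]; ring
    linarith
  rw [not_lt] at hγ
  set P := ∏ j ∈ s, (σ j + η) with hP
  have hP0 : 0 < P := Finset.prod_pos fun j hj => by linarith [hσ j hj]
  -- Since `σ j ≥ 1 / 4`, `(1 - 8 * η) * (σ j + η) ≤ σ j - η`; Bernoulli's inequality collects the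
  -- factors `1 - 8 * η`.
  have hPle : (1 - e) * P ≤ ∏ j ∈ s, (σ j - η) := by
    have hb : 1 - e ≤ (1 - 8 * η) ^ s.card := by
      have h := one_add_mul_le_pow (a := -(8 * η)) (by linarith) s.card
      have hc : (s.card : ℝ) ≤ d := by exact_mod_cast hs
      have : (s.card : ℝ) * (8 * η) ≤ d * (8 * η) :=
        mul_le_mul_of_nonneg_right hc (by linarith)
      rw [← sub_eq_add_neg] at h
      linarith
    calc (1 - e) * P ≤ (1 - 8 * η) ^ s.card * P := mul_le_mul_of_nonneg_right hb hP0.le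
      _ = ∏ j ∈ s, ((1 - 8 * η) * (σ j + η)) := by
        rw [Finset.prod_mul_distrib, Finset.prod_const]
      _ ≤ _ := by
        refine Finset.prod_le_prod (fun j hj => ?_) fun j hj => ?_
        · exact mul_nonneg (by linarith) (by linarith [hσ j hj])
        · nlinarith [hσ j hj]
  set X := (x - η) * P with hX
  have hX0 : 0 ≤ X := mul_nonneg (by linarith) hP0.le
  have hX1 : X * (1 - e) ≤ 1 + δ := by
    refine le_trans ?_ hinner
    have := mul_le_mul_of_nonneg_left hPle (show 0 ≤ x - η by linarith)
    rw [hX]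
    linarith
  have hX2 : X * (1 - (e + δ + δ')) ≤ 1 - δ' := by
    have h1 : (1 - (e + δ + δ')) * (1 + δ) ≤ (1 - e) * (1 - δ') := by
      nlinarith [mul_nonneg he0 hδ, mul_nonneg he0 hδ', mul_nonneg hδ hδ', mul_nonneg hδ hδ]
    have h2 := mul_le_mul_of_nonneg_left h1 hX0
    have h3 := mul_le_mul_of_nonneg_right hX1 (show 0 ≤ 1 - δ' by linarith)
    have h4 : X * (1 - (e + δ + δ')) * (1 + δ) ≤ (1 - δ') * (1 + δ) := by linarith
    exact le_of_mul_le_mul_right h4 (by linarith)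
  -- Both bounds now involve the same product `P` of the unchanged sides, which cancels.
  have hstep : (1 - (e + δ + δ')) * (x - η) ≤ τ + η := by
    refine le_of_mul_le_mul_right ?_ hP0
    rw [mul_assoc, ← hX]
    linarith
  have h5 : (1 - (e + δ + δ')) * (1 - Γ - η) ≤ (1 - (e + δ + δ')) * (x - η) :=
    mul_le_mul_of_nonneg_left (by linarith) (by linarith)
  have h6 : 0 ≤ (e + δ + δ') * (Γ + η) := by positivity
  have h7 : (8 * d + 2) * η = e + 2 * η := by rw [he]; ring
  nlinarith

/-- The point set `S` of a node of level `l` is, up to boundary points, that in the box with corners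
`lo` and `hi`, and the sides of this box are at least `1 - Γ l` times those of a perfectly balanced
cell. -/
structure BalancedCell (n₀ k : ℕ) (Γ : ℕ → ℝ) (p : Fin n → EuclideanSpace ℝ (Fin d))
    (S : Finset (Fin n)) (l : ℕ) (lo hi : Fin d → ℝ) : Prop where
  card_eq : S.card = n₀ * 2 ^ (k - l)
  mem_Icc : ∀ i ∈ S, ∀ j, p i j ∈ Set.Icc (lo j) (hi j)
  mem_of_mem_Ioo : ∀ i, (∀ j, p i j ∈ Set.Ioo (lo j) (hi j)) → i ∈ S
  lo_nonneg : ∀ j, 0 ≤ lo j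
  hi_le_one : ∀ j, hi j ≤ 1
  side_ge : ∀ j, 1 - Γ l ≤ 2 ^ splitCount d l j * (hi j - lo j)

/-- Bounds on the per-level errors `δ` and the accumulated errors `Γ`. -/
structure ErrorBounds (d k M : ℕ) (δ Γ : ℕ → ℝ) : Prop where
  M_ge : 40 ≤ M
  δ_nonneg : ∀ l, 0 ≤ δ l
  δ_le_one : ∀ l ≤ k, δ l ≤ 1
  Γ_nonneg : ∀ l, 0 ≤ Γ l
  Γ_le : ∀ l ≤ k, Γ l ≤ 3 / 4
  Γ_succ : ∀ l < k, Γ l + δ l + δ (l + 1) + (8 * d + 2) * (2 / M) ≤ Γ (l + 1)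

/-- The outer bound for the child and the inner bound for the parent share all factors but that of
the split coordinate, so together they bound the new side there. Cancelling the other factors
directly, rather than estimating them, keeps the loss per level additive. -/
theorem BalancedCell.child {n₀ k M : ℕ} {δ Γ : ℕ → ℝ} (hE : ErrorBounds d k M δ Γ)
    {p : Fin n → EuclideanSpace ℝ (Fin d)} (hp : GridRegular n₀ k M δ p) {S S' : Finset (Fin n)}
    {l : ℕ} (hl : l < k) {lo hi lo' hi' : Fin d → ℝ} (hS : BalancedCell n₀ k Γ p S l lo hi)
    (hcard : S'.card = n₀ * 2 ^ (k - (l + 1)))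
    (hmem : ∀ i ∈ S', ∀ j, p i j ∈ Set.Icc (lo' j) (hi' j))
    (hmem' : ∀ i, (∀ j, p i j ∈ Set.Ioo (lo' j) (hi' j)) → i ∈ S')
    (hlo : ∀ j, lo j ≤ lo' j) (hhi : ∀ j, hi' j ≤ hi j)
    (hα : lo' (splitCoord d l) ≤ hi' (splitCoord d l))
    (hlo' : ∀ j, j ≠ splitCoord d l → lo' j = lo j)
    (hhi' : ∀ j, j ≠ splitCoord d l → hi' j = hi j) :
    BalancedCell n₀ k Γ p S' (l + 1) lo' hi' := by
  set α := splitCoord d l with hαdef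
  have hM1 : 1 ≤ M := le_trans (by norm_num) hE.M_ge
  have hM40 : (40 : ℝ) ≤ M := by exact_mod_cast hE.M_ge
  have hη0 : (0 : ℝ) < 2 / M := by positivity
  have hη : (2 : ℝ) / M ≤ 1 / 20 := by
    rw [div_le_iff₀ (by linarith)]
    linarith
  have hσ : ∀ j, 1 / 4 ≤ 2 ^ splitCount d l j * (hi j - lo j) := fun j => by
    linarith [hS.side_ge j, hE.Γ_le l hl.le]
  have hlohi : ∀ j, lo j ≤ hi j := fun j => by
    have h1 : 0 < 2 ^ splitCount d l j * (hi j - lo j) := by linarith [hσ j]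
    have := pos_of_mul_pos_right h1 (by positivity)
    linarith
  have hlohi' : ∀ j, lo' j ≤ hi' j := fun j => by
    rcases eq_or_ne j α with rfl | hj
    · exact hα
    · rw [hlo' j hj, hhi' j hj]
      exact hlohi j
  have hlo0 : ∀ j, 0 ≤ lo' j := fun j => (hS.lo_nonneg j).trans (hlo j)
  have hhi1 : ∀ j, hi' j ≤ 1 := fun j => (hhi j).trans (hS.hi_le_one j)
  have houter := hp.le_prod_outer hM1 (Nat.succ_le_of_lt hl) hcard.ge hmem hlo0 hhi1 hlohi'
  have hinner := hp.prod_inner_le hM1 hl.le hS.card_eq.le hS.mem_of_mem_Ioo hS.lo_nonneg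
    hS.hi_le_one fun j => by linarith [hσ j]
  have hold : ∀ j ∈ Finset.univ.erase α, 2 ^ splitCount d (l + 1) j * (hi' j - lo' j) =
      2 ^ splitCount d l j * (hi j - lo j) := fun j hj => by
    have hj := Finset.ne_of_mem_erase hj
    rw [hlo' j hj, hhi' j hj, splitCount_succ_of_ne hj]
  rw [← Finset.mul_prod_erase _ _ (Finset.mem_univ α)] at houter hinner
  rw [Finset.prod_congr rfl fun j hj => by rw [hold j hj]] at houter
  have hside := side_ge_of_prod_bounds (s := Finset.univ.erase α) (d := d)
    (by simp) (σ := fun j => 2 ^ splitCount d l j * (hi j - lo j))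
    (fun j _ => hσ j) (hσ α) (mul_nonneg (by positivity) (sub_nonneg.2 hα)) hη0 hη
    (hE.δ_nonneg l) (hE.δ_nonneg (l + 1)) (hE.δ_le_one (l + 1) hl) (hE.Γ_nonneg l)
    (hS.side_ge α) houter hinner
  refine ⟨hcard, hmem, hmem', hlo0, hhi1, fun j => ?_⟩
  have hΓ := hE.Γ_succ l hl
  rcases eq_or_ne j α with rfl | hj
  · linarith
  · rw [hold j (Finset.mem_erase.2 ⟨hj, Finset.mem_univ j⟩)]
    have := hS.side_ge j
    have h1 := hE.δ_nonneg l
    have h2 := hE.δ_nonneg (l + 1)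
    have h3 : 0 ≤ (8 * d + 2) * (2 / (M : ℝ)) := by positivity
    linarith

/-- Without ties a median split halves `n₀ * 2 ^ (k - l)` exactly, so neither part is empty and the
recursion stops at level `k`. The factor `1 / 4` in the side bound is `1 - Γ l ≥ 1 / 4`. -/
theorem BalancedCell.sidesOK_buildTree {n₀ k M : ℕ} (hn₀ : 1 ≤ n₀) {δ Γ : ℕ → ℝ}
    (hE : ErrorBounds d k M δ Γ) {p : Fin n → EuclideanSpace ℝ (Fin d)}
    (hp : GridRegular n₀ k M δ p) (hinj : ∀ α, Function.Injective fun i => p i α) (r : ℕ)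
    {S : Finset (Fin n)} {l : ℕ} (hl : l + r = k) {lo hi : Fin d → ℝ}
    (hS : BalancedCell n₀ k Γ p S l lo hi) :
    SidesOK (fun l => 1 / (4 * 2 ^ (l / d))) (buildTree p n₀ S l) l lo hi ∧
      (buildTree p n₀ S l).depth ≤ r := by
  induction r generalizing S l lo hi with
  | zero =>
    have hlk : k - l = 0 := by omega
    have hc := hS.card_eq
    rw [hlk, pow_zero, mul_one] at hc
    rw [buildTree, if_pos (by omega)]
    exact ⟨trivial, le_rfl⟩
  | succ r ih =>
    set m := n₀ * 2 ^ (k - (l + 1)) with hm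
    have hm1 : n₀ ≤ m := Nat.le_mul_of_pos_right _ (by positivity)
    have hc : S.card = 2 * m := by
      rw [hS.card_eq, hm, show k - l = k - (l + 1) + 1 by omega, pow_succ]
      ring
    have hL := card_leftPart_of_injective (l := l) (hn₀.trans hm1) hc (hinj _)
    have hR := card_rightPart_of_injective (l := l) (hn₀.trans hm1) hc (hinj _)
    have hs : splitPos p S l ∈ Set.Icc (lo (splitCoord d l)) (hi (splitCoord d l)) :=
      splitPos_mem_Icc (Finset.card_pos.1 (by omega)) fun i hi' => hS.mem_Icc i hi' _
    have hne : ¬ (leftPart p S l = ∅ ∨ rightPart p S l = ∅) := by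
      rintro (h | h)
      · rw [h, Finset.card_empty] at hL
        omega
      · rw [h, Finset.card_empty] at hR
        omega
    have hlk : l < k := by omega
    have hSl : BalancedCell n₀ k Γ p (leftPart p S l) (l + 1) lo
        (Function.update hi (splitCoord d l) (splitPos p S l)) := by
      refine hS.child hE hp hlk hL (fun i hi' j => ?_) (fun i hi' => ?_) (fun _ => le_rfl)
        (fun j => ?_) ?_ (fun _ _ => rfl) fun j hj => Function.update_of_ne hj _ _
      · have hi'' := Finset.mem_filter.1 hi'
        have h1 := hS.mem_Icc i hi''.1 j
        rcases eq_or_ne j (splitCoord d l) with rfl | hj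
        · rw [Function.update_self]
          exact ⟨h1.1, hi''.2⟩
        · rwa [Function.update_of_ne hj]
      · refine Finset.mem_filter.2 ⟨hS.mem_of_mem_Ioo i fun j => ?_, ?_⟩
        · have h1 := hi' j
          rcases eq_or_ne j (splitCoord d l) with rfl | hj
          · rw [Function.update_self] at h1
            exact ⟨h1.1, h1.2.trans_le hs.2⟩
          · rwa [Function.update_of_ne hj] at h1
        · have h1 := hi' (splitCoord d l)
          rw [Function.update_self] at h1
          exact h1.2.le
      · rcases eq_or_ne j (splitCoord d l) with rfl | hj
        · rw [Function.update_self]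
          exact hs.2
        · rw [Function.update_of_ne hj]
      · rw [Function.update_self]
        exact hs.1
    have hSr : BalancedCell n₀ k Γ p (rightPart p S l) (l + 1)
        (Function.update lo (splitCoord d l) (splitPos p S l)) hi := by
      refine hS.child hE hp hlk hR (fun i hi' j => ?_) (fun i hi' => ?_) (fun j => ?_)
        (fun _ => le_rfl) ?_ (fun j hj => Function.update_of_ne hj _ _) (fun _ _ => rfl)
      · have hi'' := Finset.mem_filter.1 hi'
        have h1 := hS.mem_Icc i hi''.1 j
        rcases eq_or_ne j (splitCoord d l) with rfl | hj
        · rw [Function.update_self]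
          exact ⟨(not_le.1 hi''.2).le, h1.2⟩
        · rwa [Function.update_of_ne hj]
      · refine Finset.mem_filter.2 ⟨hS.mem_of_mem_Ioo i fun j => ?_, ?_⟩
        · have h1 := hi' j
          rcases eq_or_ne j (splitCoord d l) with rfl | hj
          · rw [Function.update_self] at h1
            exact ⟨hs.1.trans_lt h1.1, h1.2⟩
          · rwa [Function.update_of_ne hj] at h1
        · have h1 := hi' (splitCoord d l)
          rw [Function.update_self] at h1
          exact not_le.2 h1.1
      · rcases eq_or_ne j (splitCoord d l) with rfl | hj
        · rw [Function.update_self]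
          exact hs.1
        · rw [Function.update_of_ne hj]
      · rw [Function.update_self]
        exact hs.2
    obtain ⟨hl1, hl2⟩ := ih (by omega) hSl
    obtain ⟨hr1, hr2⟩ := ih (by omega) hSr
    rw [buildTree, if_neg (by omega), dif_neg hne]
    refine ⟨⟨hs, ?_, hl1, hr1⟩, ?_⟩
    · have h1 := hS.side_ge (splitCoord d l)
      rw [splitCount_splitCoord] at h1
      have h2 := hE.Γ_le l hlk.le
      change 1 / (4 * 2 ^ (l / d)) ≤ _
      rw [div_le_iff₀ (by positivity)]
      linarith
    · rw [KDTree.depth]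
      omega

theorem balancedCell_univ {n₀ k : ℕ} (hn : n = n₀ * 2 ^ k) {Γ : ℕ → ℝ} (hΓ : 0 ≤ Γ 0)
    {p : Fin n → EuclideanSpace ℝ (Fin d)} (hp : ∀ i, p i ∈ unitCube d) :
    BalancedCell n₀ k Γ p Finset.univ 0 (fun _ => 0) (fun _ => 1) := by
  refine ⟨by simpa using hn, fun i _ j => hp i j, fun _ _ => Finset.mem_univ _,
    fun _ => le_rfl, fun _ => le_rfl, fun j => ?_⟩
  rw [splitCount_zero]
  linarith

end Cells

/-! ### Choice of the parameters and the failure probability. -/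

section FailureProbability

variable {d : ℕ} [NeZero d]

/-- The ratio `3 / 4` makes the `δ l` summable uniformly in `k`, yet exceeds `1 / √2`, so that `2 ^
(k - l) * δ l ^ 2` does not decay towards the root. The constant `7 / 32` solves `3 / 4 * (7 / 32 +
1 / 32) + 1 / 32 = 7 / 32`. With `M = 40 * d * k` rounding costs at most `1 / (2 * k)` per level,
and in total `7 / 32 + 1 / 2 ≤ 3 / 4`. -/
theorem errorBounds_geometric {k : ℕ} (hk : 0 < k) :
    ErrorBounds d k (40 * d * k) (fun l => 1 / 32 * (3 / 4) ^ (k - l))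
      (fun l => 7 / 32 * (3 / 4) ^ (k - l) + l / (2 * k)) := by
  have hd : 1 ≤ d := NeZero.one_le
  have hd' : (1 : ℝ) ≤ d := by exact_mod_cast hd
  have hk' : (1 : ℝ) ≤ k := by exact_mod_cast hk
  have hpow : ∀ m : ℕ, ((3 : ℝ) / 4) ^ m ≤ 1 := fun m => pow_le_one₀ (by norm_num) (by norm_num)
  refine ⟨?_, fun l => by positivity, fun l _ => ?_, fun l => by positivity, fun l hl => ?_,
    fun l hl => ?_⟩
  · have : 1 ≤ d * k := Nat.mul_pos hd hk
    nlinarith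
  · linarith [hpow (k - l)]
  · have h1 : (l : ℝ) / (2 * k) ≤ 1 / 2 := by
      rw [div_le_iff₀ (by positivity)]
      have : (l : ℝ) ≤ k := by exact_mod_cast hl
      linarith
    linarith [hpow (k - l)]
  · have h1 : ((3 : ℝ) / 4) ^ (k - l) = 3 / 4 * (3 / 4) ^ (k - (l + 1)) := by
      rw [← pow_succ', show k - l = k - (l + 1) + 1 by omega]
    have h2 : (8 * d + 2) * (2 / ((40 * d * k : ℕ) : ℝ)) ≤ 1 / (2 * k) := by
      push_cast
      rw [mul_div_assoc', div_le_div_iff₀ (by positivity) (by positivity)]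
      nlinarith
    have h3 : (((l + 1 : ℕ) : ℝ)) / (2 * k) = l / (2 * k) + 1 / (2 * k) := by
      push_cast
      rw [add_div]
    simp only [h1, h3]
    linarith

/-- With `x = 2 ^ (1 / d)` the sum is dominated by a geometric one, and `x - 1 ≥ log 2 / d ≥ 1 / (2
* d)`. -/
theorem sum_two_pow_div_le (k : ℕ) :
    ∑ i ∈ Finset.range k, (2 : ℝ) ^ (i / d) ≤ 2 * d * ((2 : ℝ) ^ ((1 : ℝ) / d)) ^ k := by
  have hd : (0 : ℝ) < d := by exact_mod_cast NeZero.pos d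
  set x : ℝ := (2 : ℝ) ^ ((1 : ℝ) / d) with hx
  have hxd : x ^ d = 2 := by
    rw [hx, ← Real.rpow_natCast, ← Real.rpow_mul (by norm_num), one_div_mul_cancel hd.ne',
      Real.rpow_one]
  have hx1 : 1 + 1 / (2 * d) ≤ x := by
    rw [hx, Real.rpow_def_of_pos (by norm_num)]
    have h1 := Real.add_one_le_exp (Real.log 2 * (1 / d))
    have h2 : 1 / (2 * (d : ℝ)) ≤ Real.log 2 * (1 / d) := by
      rw [one_div, mul_inv, one_div]
      exact mul_le_mul_of_nonneg_right (by linarith [Real.log_two_gt_d9]) (by positivity)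
    linarith
  have hd2 : 0 < 1 / (2 * (d : ℝ)) := by positivity
  have hterm : ∀ i ∈ Finset.range k, (2 : ℝ) ^ (i / d) ≤ x ^ i := fun i _ => by
    rw [← hxd, ← pow_mul]
    exact pow_le_pow_right₀ (by linarith) (Nat.mul_div_le i d)
  refine (Finset.sum_le_sum hterm).trans ?_
  have hgeom := geom_sum_mul x k
  have hS0 : 0 ≤ ∑ i ∈ Finset.range k, x ^ i := Finset.sum_nonneg fun i _ => by positivity
  have h3 : (∑ i ∈ Finset.range k, x ^ i) * (1 / (2 * d)) ≤ x ^ k := by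
    have := mul_le_mul_of_nonneg_left (show 1 / (2 * (d : ℝ)) ≤ x - 1 by linarith) hS0
    linarith
  rw [mul_one_div, div_le_iff₀ (by positivity)] at h3
  linarith

theorem pi_not_gridRegular_geometric_le {n n₀ k : ℕ} (hk : 0 < k) (hn : n = n₀ * 2 ^ k) :
    (Measure.pi fun _ : Fin n => uniformCube d)
        {p | ¬ GridRegular n₀ k (40 * d * k) (fun l => 1 / 32 * (3 / 4) ^ (k - l)) p} ≤
      ENNReal.ofReal ((k + 1) * (4 ^ k * (80 * d * k) ^ (2 * d)) *
        (2 * Real.exp (-(n₀ / 8192)))) := by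
  have hE := errorBounds_geometric (d := d) hk
  have h := pi_real_not_gridRegular_le (d := d) hn (le_trans (by norm_num) hE.M_ge) hE.δ_nonneg hE.δ_le_one
    (e := n₀ / 8192) fun l _ => by
      have h1 : (2 : ℝ) ^ (k - l) * ((3 / 4) ^ (k - l)) ^ 2 = (9 / 8) ^ (k - l) := by
        rw [← pow_mul, mul_comm (k - l) 2, pow_mul, ← mul_pow]
        norm_num
      have h2 : (1 : ℝ) ≤ (9 / 8) ^ (k - l) := one_le_pow₀ (by norm_num)
      have h3 : (n₀ : ℝ) * 1 ≤ n₀ * (9 / 8) ^ (k - l) :=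
        mul_le_mul_of_nonneg_left h2 (Nat.cast_nonneg _)
      push_cast
      rw [mul_pow, show (n₀ : ℝ) * 2 ^ (k - l) * ((1 / 32) ^ 2 * ((3 / 4) ^ (k - l)) ^ 2) =
        n₀ * (2 ^ (k - l) * ((3 / 4) ^ (k - l)) ^ 2) / 1024 by ring, h1]
      linarith
  rw [← ofReal_measureReal]
  refine ENNReal.ofReal_le_ofReal (h.trans (le_of_eq ?_))
  push_cast
  ring_nf

theorem dataQueryLaw_nearSplit_le {n n₀ k : ℕ} (hk : 0 < k) (hn : n = n₀ * 2 ^ k) (hn₀ : 1 ≤ n₀)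
    {ρ : ℝ} (hρ : 0 ≤ ρ) :
    dataQueryLaw n d {ω | ω.2 ∈ nearSplit ρ (buildTree ω.1 n₀ Finset.univ 0)} ≤
      ENNReal.ofReal ((k + 1) * (4 ^ k * (80 * d * k) ^ (2 * d)) *
        (2 * Real.exp (-(n₀ / 8192)))) +
      ENNReal.ofReal (16 * d * ρ * ((2 : ℝ) ^ ((1 : ℝ) / d)) ^ k) := by
  have hE := errorBounds_geometric (d := d) hk
  set G : Set (Fin n → EuclideanSpace ℝ (Fin d)) :=
    {p | ¬ GridRegular n₀ k (40 * d * k) (fun l => 1 / 32 * (3 / 4) ^ (k - l)) p} with hG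
  set A : Set (Fin n → EuclideanSpace ℝ (Fin d)) :=
    {p | ¬ ((∀ α, Function.Injective fun i => p i α) ∧ ∀ i, p i ∈ unitCube d)} with hA
  have hA0 : (Measure.pi fun _ : Fin n => uniformCube d) A = 0 := by
    have h1 : ∀ᵐ p ∂(Measure.pi fun _ : Fin n => uniformCube d),
        ∀ α, Function.Injective fun i => p i α :=
      ae_all_iff.2 fun α => ae_injective_coord n d α
    exact ae_iff.1 (h1.and (ae_mem_unitCube n d))
  refine (prod_measure_le_add _ _ (measurableSet_nearSplit_buildTree ρ n₀ Finset.univ 0)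
    (A ∪ G) fun p hp => ?_).trans (add_le_add_left ?_ _)
  · have hpA : ¬ p ∈ A := fun h => hp (Or.inl h)
    have hpG : ¬ p ∈ G := fun h => hp (Or.inr h)
    obtain ⟨hinj, hcube⟩ := not_not.1 hpA
    obtain ⟨h1, h2⟩ := (balancedCell_univ hn (hE.Γ_nonneg 0) hcube).sidesOK_buildTree hn₀ hE
      (not_not.1 hpG) hinj k (zero_add k)
    refine (uniformCube_nearSplit_le hρ (fun l => by positivity) h1 h2).trans
      (ENNReal.ofReal_le_ofReal ?_)
    calc ∑ i ∈ Finset.range k, 2 * ρ / (1 / (4 * 2 ^ (i / d)))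
        = 8 * ρ * ∑ i ∈ Finset.range k, (2 : ℝ) ^ (i / d) := by
          rw [Finset.mul_sum]
          refine Finset.sum_congr rfl fun i _ => ?_
          rw [div_div_eq_mul_div, div_one]
          ring
      _ ≤ 8 * ρ * (2 * d * ((2 : ℝ) ^ ((1 : ℝ) / d)) ^ k) :=
          mul_le_mul_of_nonneg_left (sum_two_pow_div_le k) (by positivity)
      _ = _ := by ring
  · refine (measure_union_le _ _).trans ?_
    rw [hA0, zero_add]
    exact pi_not_gridRegular_geometric_le hk hn

theorem dataQueryLaw_not_defeatistSucceeds_le {n n₀ k : ℕ} (hk : 0 < k) (hn : n = n₀ * 2 ^ k)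
    (hn₀ : 2 ≤ n₀) :
    (dataQueryLaw n d).real {ω | ¬ DefeatistSucceeds n₀ ω.1 ω.2} ≤
      (k + 1) * (4 ^ k * (80 * d * k) ^ (2 * d)) * (2 * Real.exp (-(n₀ / 8192))) +
      24 * (d : ℝ) ^ ((3 : ℝ) / 2) *
        (Real.logb 2 (n₀ : ℝ) / (n₀ : ℝ)) ^ ((1 : ℝ) / (d : ℝ)) := by
  have hd1 : (1 : ℝ) ≤ d := by exact_mod_cast (NeZero.one_le : 1 ≤ d)
  have hn2 : (2 : ℝ) ≤ n₀ := by exact_mod_cast hn₀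
  have hlog0 : 0 ≤ Real.log n₀ := Real.log_nonneg (by linarith)
  have hlog1 : Real.log n₀ ≤ Real.logb 2 n₀ := by
    rw [Real.logb, le_div_iff₀ (Real.log_pos (by norm_num))]
    exact mul_le_of_le_one_right hlog0 (by linarith [Real.log_two_lt_d9])
  have hlogb1 : 1 ≤ Real.logb 2 n₀ := by
    rw [Real.le_logb_iff_rpow_le (by norm_num) (by linarith), Real.rpow_one]
    exact hn2
  have hlogb2 : Real.logb 2 n₀ ≤ n₀ := by
    rw [Real.logb_le_iff_le_rpow (by norm_num) (by linarith), Real.rpow_natCast]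
    exact_mod_cast Nat.lt_two_pow_self.le
  set y : ℝ := Real.logb 2 n₀ / n₀ with hy
  have hy0 : 0 ≤ y := by positivity
  have hy1 : y ≤ 1 := div_le_one_of_le₀ hlogb2 (by positivity)
  set r : ℝ := y ^ ((1 : ℝ) / d) with hr
  have hr0 : 0 ≤ r := Real.rpow_nonneg hy0 _
  have hr1 : r ≤ 1 := Real.rpow_le_one hy0 hy1 (by positivity)
  have hrd : r ^ d = y := by
    rw [hr, ← Real.rpow_natCast, ← Real.rpow_mul hy0, one_div_mul_cancel (by positivity),
      Real.rpow_one]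
  have hyr : y ≤ r := by
    calc y = r ^ d := hrd.symm
      _ ≤ r := pow_le_of_le_one hr0 hr1 (NeZero.ne d)
  set x : ℝ := (2 : ℝ) ^ ((1 : ℝ) / d) with hx
  have hx1 : 1 ≤ x := Real.one_le_rpow (by norm_num) (by positivity)
  have hxk : 1 ≤ x ^ k := one_le_pow₀ hx1
  have hxd : x ^ d = 2 := by
    rw [hx, ← Real.rpow_natCast, ← Real.rpow_mul (by norm_num), one_div_mul_cancel (by positivity),
      Real.rpow_one]
  -- This is the radius with `n * t ^ d = logb 2 n₀`.
  set t : ℝ := r / x ^ k with ht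
  have ht0 : 0 ≤ t := by positivity
  have ht1 : t ≤ 1 := div_le_one_of_le₀ (hr1.trans hxk) (by positivity)
  have hnt : (n : ℝ) * t ^ d = Real.logb 2 n₀ := by
    rw [ht, div_pow, hrd, ← pow_mul, mul_comm k d, pow_mul, hxd, hy, hn]
    push_cast
    field_simp
  have hsub : {ω : (Fin n → EuclideanSpace ℝ (Fin d)) × EuclideanSpace ℝ (Fin d) |
      ¬ DefeatistSucceeds n₀ ω.1 ω.2} ⊆
      {ω | ∀ i, ¬ ∀ j, |ω.1 i j - ω.2 j| ≤ t} ∪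
      {ω | ω.2 ∈ nearSplit (√d * t) (buildTree ω.1 n₀ Finset.univ 0)} := by
    intro ω hω
    by_contra hcon
    simp only [Set.mem_union, Set.mem_ofPred_eq, not_or] at hcon hω
    obtain ⟨hi, hnear⟩ := hcon
    obtain ⟨i, hi⟩ := not_forall.1 hi
    exact hω (defeatistSucceeds_of_notMem_nearSplit hnear
      ⟨i, norm_sub_le_of_coord ht0 (not_not.1 hi)⟩)
  set a : ℝ := (k + 1) * (4 ^ k * (80 * d * k) ^ (2 * d)) * (2 * Real.exp (-(n₀ / 8192))) with ha
  have ha0 : 0 ≤ a := by positivity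
  have hb0 : 0 ≤ 16 * d * (√d * t) * x ^ k := by positivity
  have hmeas := (measure_mono (μ := dataQueryLaw n d) hsub).trans ((measure_union_le _ _).trans
    (add_le_add (dataQueryLaw_no_data_near_le n d ht0 ht1)
      (dataQueryLaw_nearSplit_le hk hn (by omega) (ρ := √d * t) (by positivity))))
  rw [hnt, ← ENNReal.ofReal_add ha0 hb0, ← ENNReal.ofReal_add (Real.exp_pos _).le (by positivity)]
    at hmeas
  refine (ENNReal.toReal_le_of_le_ofReal (by positivity) hmeas).trans ?_
  -- The event of no nearby data costs at most one more `r`, so `17 * d ^ (3 / 2) * r` would suffice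
  -- in place of `24 * d ^ (3 / 2) * r`.
  have h1 : Real.exp (-Real.logb 2 n₀) ≤ r := by
    calc Real.exp (-Real.logb 2 n₀) ≤ Real.exp (-Real.log n₀) :=
          Real.exp_le_exp.2 (neg_le_neg hlog1)
      _ = 1 / n₀ := by rw [Real.exp_neg, Real.exp_log (by linarith), one_div]
      _ ≤ y := div_le_div_of_nonneg_right hlogb1 (by positivity)
      _ ≤ r := hyr
  have hd32 : (d : ℝ) ^ ((3 : ℝ) / 2) = d * √d := by
    rw [show (3 : ℝ) / 2 = 1 + 1 / 2 by norm_num, Real.rpow_add (by linarith), Real.rpow_one,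
      Real.sqrt_eq_rpow]
  have h2 : 16 * d * (√d * t) * x ^ k = 16 * (d * √d) * r := by
    rw [ht]
    field_simp
  have h3 : 1 ≤ d * √d := by
    have : 1 ≤ √d := Real.one_le_sqrt.2 hd1
    nlinarith
  rw [h2, hd32]
  nlinarith [mul_le_mul_of_nonneg_right h3 hr0]

/-- With `z` the fourth root of `x`, `log z ≤ z` bounds the left side by `48 * √x`. -/
theorem four_mul_log_add_two_mul_log_sq_le {x : ℝ} (hx : 10 ^ 12 ≤ x) :
    4 * Real.log x + 2 * Real.log x ^ 2 ≤ x / 16384 := by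
  have hx0 : 0 ≤ x := by linarith
  set s := √x with hs
  have hs2 : s ^ 2 = x := Real.sq_sqrt hx0
  have hs6 : 10 ^ 6 ≤ s := Real.le_sqrt_of_sq_le (by linarith)
  set z := √s with hz
  have hz2 : z ^ 2 = s := Real.sq_sqrt (by linarith)
  have hz1 : 1 ≤ z := Real.one_le_sqrt.2 (by linarith)
  have hlog : Real.log x = 4 * Real.log z := by
    rw [← hs2, ← hz2, Real.log_pow, Real.log_pow]
    push_cast
    ring
  have h1 : Real.log z ≤ z := by linarith [Real.log_le_sub_one_of_pos (show 0 < z by linarith)]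
  have h0 : 0 ≤ Real.log z := Real.log_nonneg hz1
  have h2 : Real.log z ^ 2 ≤ s := by rw [← hz2]; gcongr
  have h3 : Real.log z ≤ s := by nlinarith
  rw [hlog, ← hs2]
  nlinarith

/-- Nontriviality of the claim supplies the estimates: `h1` gives `n₀ ≥ 10 ^ 12` and `2 ^ k ≤ exp
(n₀ / 10 ^ 12)`, while `h2` gives `(24 * d ^ (3 / 2)) ^ d ≤ n₀`, hence `d ≤ log n₀`. So the number
of grid boxes is at most `exp` of a quantity below `n₀ / 8192`. -/
theorem grid_error_le {n n₀ k : ℕ} (hk : 0 < k) (hn : n = n₀ * 2 ^ k) (hn₀ : 2 ≤ n₀)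
    (hkn : k ≤ n₀) (h1 : 3 * (n : ℝ) * Real.exp (-(1 / 10 ^ 12) * (n₀ : ℝ)) < 1)
    (h2 : 24 * (d : ℝ) ^ ((3 : ℝ) / 2) *
      (Real.logb 2 (n₀ : ℝ) / (n₀ : ℝ)) ^ ((1 : ℝ) / (d : ℝ)) < 1) :
    (k + 1) * (4 ^ k * (80 * d * k) ^ (2 * d)) * (2 * Real.exp (-(n₀ / 8192))) ≤
      3 * (n : ℝ) * Real.exp (-(1 / 10 ^ 12) * (n₀ : ℝ)) := by
  have hd1 : (1 : ℝ) ≤ d := by exact_mod_cast (NeZero.one_le : 1 ≤ d)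
  have hn2 : (2 : ℝ) ≤ n₀ := by exact_mod_cast hn₀
  have hlogb1 : 1 ≤ Real.logb 2 n₀ := by
    rw [Real.le_logb_iff_rpow_le (by norm_num) (by linarith), Real.rpow_one]
    exact hn2
  have hcast : (n : ℝ) = n₀ * 2 ^ k := by rw [hn]; push_cast; ring
  have h2k : (1 : ℝ) ≤ 2 ^ k := one_le_pow₀ (by norm_num)
  have hnexp : 3 * (n : ℝ) < Real.exp (n₀ / 10 ^ 12) := by
    rw [neg_mul, Real.exp_neg, ← div_eq_mul_inv, div_lt_one (Real.exp_pos _)] at h1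
    rwa [one_div_mul_eq_div] at h1
  -- Otherwise `3 * n` would be less than `exp 1`.
  have hlarge : (10 : ℝ) ^ 12 ≤ n₀ := by
    by_contra! hlt
    have h3 : Real.exp (n₀ / 10 ^ 12) ≤ Real.exp 1 :=
      Real.exp_le_exp.2 (div_le_one_of_le₀ hlt.le (by positivity))
    have h4 : (n : ℝ) ≥ 2 := by rw [hcast]; nlinarith
    linarith [Real.exp_one_lt_d9]
  set L := Real.log n₀ with hL
  have hexpL : Real.exp L = n₀ := Real.exp_log (by linarith)
  have hL0 : 0 ≤ L := Real.log_nonneg (by linarith)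
  have h2kexp : (2 : ℝ) ^ k ≤ Real.exp (n₀ / 10 ^ 12) := by nlinarith
  have hk1 : (k : ℝ) + 1 ≤ Real.exp (n₀ / 10 ^ 12) := by
    refine le_trans ?_ h2kexp
    exact_mod_cast Nat.lt_two_pow_self
  have h4k : (4 : ℝ) ^ k ≤ Real.exp (n₀ / 10 ^ 12) * Real.exp (n₀ / 10 ^ 12) := by
    have : (4 : ℝ) ^ k = 2 ^ k * 2 ^ k := by rw [← mul_pow]; norm_num
    rw [this]
    gcongr
  set w : ℝ := 24 * (d : ℝ) ^ ((3 : ℝ) / 2) with hw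
  have hd32 : 1 ≤ (d : ℝ) ^ ((3 : ℝ) / 2) := Real.one_le_rpow hd1 (by norm_num)
  have hw24 : 24 ≤ w := by linarith
  have hwd : w ^ d ≤ n₀ := by
    have hy0 : 0 ≤ Real.logb 2 n₀ / n₀ := by positivity
    have h3 := pow_le_one₀ (n := d) (by positivity) h2.le
    rw [mul_pow, ← Real.rpow_natCast (_ ^ ((1 : ℝ) / d)), ← Real.rpow_mul hy0,
      one_div_mul_cancel (by positivity), Real.rpow_one, mul_div_assoc',
      div_le_one (by linarith)] at h3
    have h4 : w ^ d * 1 ≤ w ^ d * Real.logb 2 n₀ :=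
      mul_le_mul_of_nonneg_left hlogb1 (by positivity)
    linarith
  have hdL : (d : ℝ) ≤ L := by
    rw [hL, Real.le_log_iff_exp_le (by linarith), ← mul_one (d : ℝ), Real.exp_nat_mul]
    refine (pow_le_pow_left₀ (Real.exp_pos 1).le ?_ d).trans hwd
    linarith [Real.exp_one_lt_d9]
  have hbase : 80 * (d : ℝ) * k ≤ w ^ 2 * n₀ := by
    have hw2 : w ^ 2 = 576 * (d : ℝ) ^ 3 := by
      rw [hw, mul_pow, ← Real.rpow_natCast (_ ^ ((3 : ℝ) / 2)), ← Real.rpow_mul (by linarith)]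
      norm_num
    have hd3 : (d : ℝ) ≤ (d : ℝ) ^ 3 := le_self_pow₀ hd1 (by norm_num)
    have hkn' : (k : ℝ) ≤ n₀ := by exact_mod_cast hkn
    rw [hw2]
    have : 80 * (d : ℝ) ≤ 576 * (d : ℝ) ^ 3 := by linarith
    gcongr
  have hpow : (80 * (d : ℝ) * k) ^ (2 * d) ≤ Real.exp (n₀ / 16384) := by
    calc (80 * (d : ℝ) * k) ^ (2 * d) ≤ (w ^ 2 * n₀) ^ (2 * d) := by gcongr
      _ = (w ^ d) ^ 4 * (n₀ : ℝ) ^ (2 * d) := by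
        rw [mul_pow, ← pow_mul, ← pow_mul]
        congr 2
        ring
      _ ≤ (n₀ : ℝ) ^ 4 * (n₀ : ℝ) ^ (2 * d) := by gcongr
      _ = Real.exp (4 * L + 2 * d * L) := by
        rw [← pow_add, ← hexpL, ← Real.exp_nat_mul]
        push_cast
        ring_nf
      _ ≤ Real.exp (n₀ / 16384) := by
        refine Real.exp_le_exp.2 (le_trans ?_ (four_mul_log_add_two_mul_log_sq_le hlarge))
        nlinarith
  calc (k + 1) * (4 ^ k * (80 * (d : ℝ) * k) ^ (2 * d)) * (2 * Real.exp (-(n₀ / 8192)))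
      ≤ Real.exp (n₀ / 10 ^ 12) * (Real.exp (n₀ / 10 ^ 12) * Real.exp (n₀ / 10 ^ 12) *
          Real.exp (n₀ / 16384)) * (2 * Real.exp (-(n₀ / 8192))) := by gcongr
    _ = 2 * Real.exp (n₀ / 10 ^ 12 + (n₀ / 10 ^ 12 + n₀ / 10 ^ 12 + n₀ / 16384) +
          -(n₀ / 8192)) := by
        simp only [Real.exp_add]
        ring
    _ ≤ 2 * Real.exp (-(1 / 10 ^ 12) * (n₀ : ℝ)) := by
        have : (n₀ : ℝ) / 10 ^ 12 + (n₀ / 10 ^ 12 + n₀ / 10 ^ 12 + n₀ / 16384) + -(n₀ / 8192) ≤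
            -(1 / 10 ^ 12) * (n₀ : ℝ) := by
          linarith
        have := Real.exp_le_exp.2 this
        linarith
    _ ≤ _ := by
        have h5 : 2 ≤ 3 * (n : ℝ) := by rw [hcast]; nlinarith
        exact mul_le_mul_of_nonneg_right h5 (Real.exp_pos _).le

end FailureProbability

theorem theorem4p3 :
    ∃ c : ℝ, 0 < c ∧
      ∀ (d : ℕ) [NeZero d] (n n₀ k : ℕ), 0 < k → n = n₀ * 2 ^ k → 11 ≤ n₀ →
        2 * Real.logb 2 (n : ℝ) ≤ (n₀ : ℝ) →
          1 - 3 * (n : ℝ) * Real.exp (-c * (n₀ : ℝ))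
              - 24 * (d : ℝ) ^ ((3 : ℝ) / 2)
                * (Real.logb 2 (n₀ : ℝ) / (n₀ : ℝ)) ^ ((1 : ℝ) / (d : ℝ))
            ≤ (dataQueryLaw n d).real {ω | DefeatistSucceeds n₀ ω.1 ω.2} := by
  -- So small a constant makes the bound vacuous unless `n₀ ≥ 10 ^ 12`, where `n₀ / 16384` dominates
  -- the logarithmic terms of the union bound.
  refine ⟨1 / 10 ^ 12, by positivity, fun d _ n n₀ k hk hn hn₀ hlog => ?_⟩
  have hn₀' : (11 : ℝ) ≤ n₀ := by exact_mod_cast hn₀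
  have hnonneg : 0 ≤ (dataQueryLaw n d).real {ω | DefeatistSucceeds n₀ ω.1 ω.2} :=
    measureReal_nonneg
  have ha0 : 0 ≤ 3 * (n : ℝ) * Real.exp (-(1 / 10 ^ 12) * (n₀ : ℝ)) := by positivity
  have hb0 : 0 ≤ 24 * (d : ℝ) ^ ((3 : ℝ) / 2) *
      (Real.logb 2 (n₀ : ℝ) / (n₀ : ℝ)) ^ ((1 : ℝ) / (d : ℝ)) := by
    have : 0 ≤ Real.logb 2 (n₀ : ℝ) := Real.logb_nonneg (by norm_num) (by linarith)
    positivity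
  by_cases h1 : 1 ≤ 3 * (n : ℝ) * Real.exp (-(1 / 10 ^ 12) * (n₀ : ℝ))
  · linarith
  by_cases h2 : 1 ≤ 24 * (d : ℝ) ^ ((3 : ℝ) / 2) *
      (Real.logb 2 (n₀ : ℝ) / (n₀ : ℝ)) ^ ((1 : ℝ) / (d : ℝ))
  · linarith
  rw [not_le] at h1 h2
  have hkn : k ≤ n₀ := by
    have h3 : (k : ℝ) ≤ Real.logb 2 n := by
      rw [Real.le_logb_iff_rpow_le (by norm_num) (by rw [hn]; positivity), Real.rpow_natCast, hn]
      push_cast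
      exact le_mul_of_one_le_left (by positivity) (by linarith)
    have h4 : (k : ℝ) ≤ n₀ := by
      have : (0 : ℝ) ≤ k := Nat.cast_nonneg k
      linarith
    exact_mod_cast h4
  have hfail := dataQueryLaw_not_defeatistSucceeds_le (d := d) hk hn (by omega)
  have hgrid := grid_error_le (d := d) hk hn (by omega) hkn h1 h2
  have hprob : IsProbabilityMeasure (dataQueryLaw n d) := by
    rw [dataQueryLaw]; infer_instance
  -- Subadditivity is enough here, so the success event need not be shown measurable.
  have htotal : 1 ≤ (dataQueryLaw n d).real {ω | DefeatistSucceeds n₀ ω.1 ω.2} +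
      (dataQueryLaw n d).real {ω | ¬ DefeatistSucceeds n₀ ω.1 ω.2} := by
    rw [← probReal_univ (μ := dataQueryLaw n d)]
    refine le_trans (measureReal_mono (fun ω _ => ?_) (measure_ne_top _ _))
      (measureReal_union_le _ _)
    exact em (DefeatistSucceeds n₀ ω.1 ω.2)
  linarith
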